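/- Let $(E,[\cdot,\cdot]_E,\sigma)$ be a Lie algebroid of rank $m$ over a smooth $n$-manifold $M$ with projection $\pi:E\to M$, and let $\mathcal TE\to E$ be its prolongation, $\mathcal T_wE=\{(u,v)\in E_{\pi(w)}\times T_wE:\sigma(u)=T_w\pi(v)\}$, which is a Lie algebroid over $E$ with anchor $\sigma^1(u,v)=v$ and a bracket $[\cdot,\cdot]_{\mathcal TE}$. Let $J(u,v)=(0,u^{v}_w)$ be the vertical endomorphism ($u^v_w\in T_wE$ is the vertical lift of $u$) and let $\mathbb C(w)=(0,w^v_w)$ be the Euler section. All sections and functions below are smooth on $E\setminus\{0\}$ (the total space without the zero section), and identities between them hold there. Let $\mathcal S$ be a semispray (a section of $\mathcal TE$ with $J\mathcal S=\mathbb C$), let $\mathcal N:\mathcal TE\to\mathcal TE$ be an arbitrary nonlinear connection (a bundle morphism with $\mathcal N^2=\mathrm{Id}$ and $\ker(\mathrm{Id}+\mathcal N)=\{(u,v):u=0\}$), and put $\mathrm h=\frac12(\mathrm{Id}+\mathcal N)$, $\mathrm v=\frac12(\mathrm{Id}-\mathcal N)$, $\mathcal L_{\mathcal S}X=[\mathcal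 S,X]_{\mathcal TE}$, $\mathcal S(f)=\sigma^1(\mathcal S)f$. The dynamical covariant derivative is $\nabla=\mathrm h\circ\mathcal L_{\mathcal S}\circ\mathrm h+\mathrm v\circ\mathcal L_{\mathcal S}\circ\mathrm v$ on sections, $\nabla f=\mathcal S(f)$ on functions, and $\nabla T=\nabla\circ T-T\circ\nabla$, $\mathcal L_{\mathcal S}T=\mathcal L_{\mathcal S}\circ T-T\circ\mathcal L_{\mathcal S}$ on $(1,1)$-tensors. Let $\mathfrak X_{\mathcal S}=\ker(J\circ\mathcal L_{\mathcal S})$ be the set of Newtonoid sections, and let $f*X=(\mathrm{Id}+J\circ\mathcal L_{\mathcal S})(fX)$, which equals $fX+\mathcal S(f)JX$ for $X\in\mathfrak X_{\mathcal S}$. Assume that the vector field $\sigma^1(\mathcal S)$ does not vanish identically on any nonempty open subset of $E\setminus\{0\}$. Then the following conditions are equivalent: (i) $\nabla$ restricts to a map $\mathfrak X_{\mathcal S}\to\mathfrak X_{\mathcal S}$ and satisfies the Leibniz rule $\nabla(f*X)=(\nabla f)*X+f*\nabla X$ for all $f\in C^\infty(E\setminus\{0\})$ and $X\in\mathfrak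 X_{\mathcal S}$; (ii) $\nabla J=0$; (iii) $\mathcal L_{\mathcal S}J+\mathcal N=0$; (iv) in all local coordinates $(x^i,y^\alpha)$ of $E$ given by a local frame $\{s_\alpha\}$ with $[s_\alpha,s_\beta]_E=L_{\alpha\beta}^\gamma s_\gamma$, $$\mathcal N_\alpha^\beta=\tfrac12\Big(-\frac{\partial\mathcal S^\beta}{\partial y^\alpha}+y^\varepsilon L_{\alpha\varepsilon}^\beta\Big).$$ Here $\mathcal X_\alpha=(s_\alpha,\sigma_\alpha^i\,\partial/\partial x^i)$ and $\mathcal V_\alpha=(0,\partial/\partial y^\alpha)$ are the induced local frame of $\mathcal TE$, with $\sigma(s_\alpha)=\sigma_\alpha^i\,\partial/\partial x^i$; $\mathcal S=y^\alpha\mathcal X_\alpha+\mathcal S^\alpha\mathcal V_\alpha$; and $\mathcal N(\mathcal X_\alpha)=\mathcal X_\alpha-2\mathcal N_\alpha^\beta\mathcal V_\beta$. Thus, under this assumption, $\mathcal N$ satisfies (i) if and only if it is the canonical connection $\mathcal N=-\mathcal L_{\mathcal S}J$. Without the assumption on $\sigma^1(\mathcal S)$, conditions (ii), (iii), (iv)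 are still equivalent and imply (i). -/

import Mathlib

open Bundle Set Filter
open scoped Manifold Topology ContDiff

set_option linter.unusedSectionVars false

noncomputable section

namespace LieAlgebroid

section Aux

variable {V : Type*} [NormedAddCommGroup V] [NormedSpace ℝ V] [CompleteSpace V]
  {H : Type*} [TopologicalSpace H] {I : ModelWithCorners ℝ V H}
  {P : Type*} [TopologicalSpace P] [ChartedSpace H P] [IsManifold I ∞ P]

/-- The derivative of a smooth function along a smooth vector field is smooth. -/
lemma contMDiffAt_mvfderiv_apply {f : P → ℝ} {U : Set P} {x : P}
    (hU : IsOpen U) (hx : x ∈ U) (hf : ContMDiffOn I 𝓘(ℝ, ℝ) ∞ f U)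
    {W : ∀ y : P, TangentSpace I y}
    (hW : ContMDiffAt I I.tangent ∞ (fun y => (⟨y, W y⟩ : TangentBundle I P)) x) :
    ContMDiffAt I 𝓘(ℝ, ℝ) ∞ (fun y => mvfderiv I f y (W y)) x := by
  have h1 := hf.contMDiffOn_tangentMapWithin (m := ∞) (by simp) hU.uniqueMDiffOn
  have hopen : IsOpen (π V (TangentSpace I : P → Type _) ⁻¹' U) :=
    hU.preimage (FiberBundle.continuous_proj V (TangentSpace I : P → Type _))
  have h2 := h1.contMDiffAt (x := (⟨x, W x⟩ : TangentBundle I P)) (hopen.mem_nhds hx)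
  have h3 := (h2.comp x hW)
  have h4 := (contMDiff_snd_tangentBundle_modelSpace (n := ∞) ℝ 𝓘(ℝ, ℝ)).contMDiffAt.comp x h3
  refine h4.congr_of_eventuallyEq ?_
  filter_upwards [hU.mem_nhds hx] with y hy
  simp only [Function.comp, tangentMapWithin, mfderivWithin_of_isOpen hU hy]
  rfl

/-- The bracket of vector fields acts on functions as the commutator. -/
lemma mvfderiv_mlieBracket {f : P → ℝ} {U : Set P} {x : P}
    (hU : IsOpen U) (hx : x ∈ U) (hf : ContMDiffOn I 𝓘(ℝ, ℝ) ∞ f U)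
    {X Y : ∀ y : P, TangentSpace I y}
    (hX : ContMDiffAt I I.tangent ∞ (fun y => (⟨y, X y⟩ : TangentBundle I P)) x)
    (hY : ContMDiffAt I I.tangent ∞ (fun y => (⟨y, Y y⟩ : TangentBundle I P)) x) :
    mvfderiv I f x (VectorField.mlieBracket I X Y x)
      = mvfderiv I (fun y => mvfderiv I f y (Y y)) x (X x)
        - mvfderiv I (fun y => mvfderiv I f y (X y)) x (Y x) := by
  have : IsManifold I (minSmoothness ℝ 2) P := by
    rw [minSmoothness_of_isRCLikeNormedField]; infer_instance
  have : IsManifold I (minSmoothness ℝ 3) P := by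
    rw [minSmoothness_of_isRCLikeNormedField]
    exact IsManifold.of_le (n := ∞) ENat.LEInfty.out
  have two : (minSmoothness ℝ 2) ≤ (∞ : WithTop ℕ∞) := by
    rw [minSmoothness_of_isRCLikeNormedField]
    exact ENat.LEInfty.out
  by_cases hsub : ∃ u : TangentSpace I x, u ≠ 0
  swap
  · push Not at hsub
    rw [hsub (VectorField.mlieBracket I X Y x), hsub (X x), hsub (Y x)]
    simp
  obtain ⟨u, hu⟩ := hsub
  set Z := FiberBundle.extend V u with hZdef
  have hZ : ContMDiffAt I I.tangent ∞ (fun y => (⟨y, Z y⟩ : TangentBundle I P)) x :=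
    FiberBundle.contMDiffAt_extend I V u
  have hfx : ContMDiffAt I 𝓘(ℝ, ℝ) ∞ f x := hf.contMDiffAt (hU.mem_nhds hx)
  have hfZ := hfx.smul_section hZ
  have lb : ∀ {A B : ∀ y : P, TangentSpace I y},
      ContMDiffAt I I.tangent ∞ (fun y => (⟨y, A y⟩ : TangentBundle I P)) x →
      ContMDiffAt I I.tangent ∞ (fun y => (⟨y, B y⟩ : TangentBundle I P)) x →
      MDifferentiableAt I I.tangent
        (fun y => (⟨y, VectorField.mlieBracket I A B y⟩ : TangentBundle I P)) x := by
    intro A B hA hB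
    have : IsManifold I (((2 : ℕ∞) : WithTop ℕ∞) + 1) P :=
      IsManifold.of_le (n := ∞) (by exact_mod_cast (le_top : (2 + 1 : ℕ∞) ≤ ⊤))
    have := ContMDiffAt.mlieBracket_vectorField (m := 1) (n := 2)
      (hA.of_le (by exact_mod_cast le_top)) (hB.of_le (by exact_mod_cast le_top)) (by simp; norm_num)
    exact this.mdifferentiableAt (by simp)
  have nbhd : ∀ {A : ∀ y : P, TangentSpace I y},
      (A = Z) → ∀ᶠ y in 𝓝 x, MDifferentiableAt I I.tangent
        (fun y => (⟨y, A y⟩ : TangentBundle I P)) y := by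
    rintro A rfl
    obtain ⟨s, hs, hsm⟩ := FiberBundle.exists_contMDiffOn_extend (k := ∞) I V u
    filter_upwards [eventually_mem_nhds_iff.2 hs] with y hy
    exact (hsm.contMDiffAt hy).mdifferentiableAt (by simp)
  have fnb : ∀ᶠ y in 𝓝 x, MDifferentiableAt I 𝓘(ℝ, ℝ) f y := by
    filter_upwards [hU.mem_nhds hx] with y hy
    exact (hf.contMDiffAt (hU.mem_nhds hy)).mdifferentiableAt (by simp)
  have key : ∀ {A B : ∀ y : P, TangentSpace I y},
      ContMDiffAt I I.tangent ∞ (fun y => (⟨y, A y⟩ : TangentBundle I P)) x →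
      ContMDiffAt I I.tangent ∞ (fun y => (⟨y, B y⟩ : TangentBundle I P)) x →
      VectorField.mlieBracket I B (VectorField.mlieBracket I A (f • Z)) x
        = mvfderiv I (fun y => mvfderiv I f y (A y)) x (B x) • Z x
          + mvfderiv I f x (A x) • VectorField.mlieBracket I B Z x
          + (mvfderiv I f x (B x) • VectorField.mlieBracket I A Z x
            + f x • VectorField.mlieBracket I B (VectorField.mlieBracket I A Z) x) := by
    intro A B hA hB
    have e1 : VectorField.mlieBracket I A (f • Z) =ᶠ[𝓝 x]
        (fun y => mvfderiv I f y (A y)) • Z + f • VectorField.mlieBracket I A Z := by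
      filter_upwards [nbhd rfl, fnb] with y h1 h2
      exact VectorField.mlieBracket_smul_right h2 h1
    have d1 := (contMDiffAt_mvfderiv_apply hU hx hf hA)
    have dZ := hZ.mdifferentiableAt (n := ∞) (by simp)
    rw [Filter.EventuallyEq.mlieBracket_vectorField_eq (EventuallyEq.refl _ B) e1]
    rw [VectorField.mlieBracket_add_right, VectorField.mlieBracket_smul_right,
      VectorField.mlieBracket_smul_right]
    · exact hfx.mdifferentiableAt (by simp)
    · exact lb hA hZ
    · exact d1.mdifferentiableAt (by simp)
    · exact dZ
    · exact (d1.smul_section hZ).mdifferentiableAt (by simp)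
    · exact (hfx.mdifferentiableAt (by simp)).smul_section (lb hA hZ)
  have jac := VectorField.leibniz_identity_mlieBracket_apply (I := I) (U := X) (V := Y) (W := f • Z)
    (x := x) (hX.of_le two) (hY.of_le two)
    (hfZ.of_le two)
  have jacZ := VectorField.leibniz_identity_mlieBracket_apply (I := I) (U := X) (V := Y) (W := Z)
    (x := x) (hX.of_le two) (hY.of_le two)
    (hZ.of_le two)
  rw [key hY hX, key hX hY, VectorField.mlieBracket_smul_right
    (hfx.mdifferentiableAt (by simp)) (hZ.mdifferentiableAt (by simp)), jacZ] at jac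
  have hZx : Z x = u := by simp [hZdef]
  rw [hZx] at jac
  have fin : (mvfderiv I f x (VectorField.mlieBracket I X Y x)
      - (mvfderiv I (fun y => mvfderiv I f y (Y y)) x (X x)
        - mvfderiv I (fun y => mvfderiv I f y (X y)) x (Y x))) • u = 0 := by
    rw [sub_smul, sub_smul]
    generalize mvfderiv I (fun y => mvfderiv I f y (Y y)) x (X x) = a1 at *
    generalize mvfderiv I (fun y => mvfderiv I f y (X y)) x (Y x) = a2 at *
    generalize mvfderiv I f x (VectorField.mlieBracket I X Y x) = a3 at *
    have j2 := sub_eq_zero.2 jac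
    rw [← neg_eq_zero, ← j2, smul_add]
    abel
  rcases smul_eq_zero.1 fin with h | h
  · exact sub_eq_zero.1 h
  · exact absurd h hu

end Aux

end LieAlgebroid

/-- The model fibre `ℝ^m` of a vector bundle of rank `m`. -/
abbrev Fib (m : ℕ) : Type := EuclideanSpace ℝ (Fin m)

/-- The model with corners of the total space of a vector bundle of rank `m` over an
`n`-dimensional manifold. -/
abbrev totModel (n m : ℕ) :
    ModelWithCorners ℝ (EuclideanSpace ℝ (Fin n) × Fib m)
      (ModelProd (EuclideanSpace ℝ (Fin n)) (Fib m)) :=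
  (𝓡 n).prod 𝓘(ℝ, Fib m)

/-- A Lie algebroid structure on a smooth vector bundle `E → M`: a Lie bracket on the space of
smooth sections and a smooth bundle map `E → TM` (the anchor) which induces a homomorphism of
Lie algebras and satisfies the Leibniz rule. -/
structure LieAlgebroid (n m : ℕ) {M : Type*} [TopologicalSpace M]
    [ChartedSpace (EuclideanSpace ℝ (Fin n)) M] [IsManifold (𝓡 n) ∞ M]
    (E : M → Type*) [TopologicalSpace (TotalSpace (Fib m) E)]
    [∀ x, AddCommGroup (E x)] [∀ x, Module ℝ (E x)] [∀ x, TopologicalSpace (E x)]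
    [FiberBundle (Fib m) E] [VectorBundle ℝ (Fib m) E]
    [ContMDiffVectorBundle ∞ (Fib m) E (𝓡 n)] where
  /-- The bracket of sections, an `ℝ`-bilinear operation. -/
  bracket : Cₛ^∞⟮𝓡 n; Fib m, E⟯ →ₗ[ℝ] Cₛ^∞⟮𝓡 n; Fib m, E⟯ →ₗ[ℝ] Cₛ^∞⟮𝓡 n; Fib m, E⟯
  bracket_self : ∀ s, bracket s s = 0
  jacobi : ∀ s₁ s₂ s₃, bracket s₁ (bracket s₂ s₃) + bracket s₂ (bracket s₃ s₁)
    + bracket s₃ (bracket s₁ s₂) = 0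
  /-- The anchor, linear on the fibres. -/
  anchor : ∀ x : M, E x →ₗ[ℝ] TangentSpace (𝓡 n) x
  anchor_smooth : ContMDiff (totModel n m) (𝓡 n).tangent ∞
    (fun p : TotalSpace (Fib m) E => (⟨p.proj, anchor p.proj p.2⟩ : TangentBundle (𝓡 n) M))
  anchor_bracket : ∀ (s t : Cₛ^∞⟮𝓡 n; Fib m, E⟯) (x : M),
    anchor x (bracket s t x) = VectorField.mlieBracket (𝓡 n)
      (fun y => anchor y (s y)) (fun y => anchor y (t y)) x
  leibniz : ∀ (s t ft : Cₛ^∞⟮𝓡 n; Fib m, E⟯) (f : M → ℝ), ContMDiff (𝓡 n) 𝓘(ℝ, ℝ) ∞ f →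
    (∀ x, ft x = f x • t x) →
    ∀ x, bracket s ft x = f x • bracket s t x + mvfderiv (𝓡 n) f x (anchor x (s x)) • t x

namespace LieAlgebroid

variable {n m : ℕ} {M : Type*} [TopologicalSpace M]
  [ChartedSpace (EuclideanSpace ℝ (Fin n)) M] [IsManifold (𝓡 n) ∞ M]
  {E : M → Type*} [TopologicalSpace (TotalSpace (Fib m) E)]
  [∀ x, AddCommGroup (E x)] [∀ x, Module ℝ (E x)] [∀ x, TopologicalSpace (E x)]
  [FiberBundle (Fib m) E] [VectorBundle ℝ (Fib m) E]
  [ContMDiffVectorBundle ∞ (Fib m) E (𝓡 n)]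

open Classical in
/-- The value at `x` of the bracket of two local sections which are smooth near `x`: the bracket
of any two global smooth sections which agree with them near `x`. (The bracket is a local
operator by the Leibniz rule, so the choice does not matter.) -/
def localBracket (A : LieAlgebroid n m E) (s t : ∀ y : M, E y) (x : M) : E x :=
  if h : ∃ p : Cₛ^∞⟮𝓡 n; Fib m, E⟯ × Cₛ^∞⟮𝓡 n; Fib m, E⟯,
      (∀ᶠ y in 𝓝 x, p.1 y = s y) ∧ (∀ᶠ y in 𝓝 x, p.2 y = t y)
  then A.bracket h.choose.1 h.choose.2 x else 0

/-! ### The prolongation `𝒯E → E` -/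

/-- The fibre `𝒯_wE = {(u, v) ∈ E_x × T_wE | σ(u) = T_wπ(v)}`, `x = π(w)`. -/
def Prol (A : LieAlgebroid n m E) (w : TotalSpace (Fib m) E) :
    Submodule ℝ (E w.proj × TangentSpace (totModel n m) w) :=
  LinearMap.eqLocus (A.anchor w.proj ∘ₗ LinearMap.fst ℝ _ _)
    ((mfderiv (totModel n m) (𝓡 n) (TotalSpace.proj : TotalSpace (Fib m) E → M) w).toLinearMap
      ∘ₗ LinearMap.snd ℝ _ _)

/-- The total space without the zero section, `E∖{0}`. -/
def slit (m : ℕ) {M : Type*} (E : M → Type*) [∀ x, AddCommGroup (E x)] :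
    Set (TotalSpace (Fib m) E) :=
  {w | w.2 ≠ 0}

/-- A (not necessarily smooth) section of `𝒯E`. Only its restriction to `E∖{0}` is used. -/
abbrev Sec (A : LieAlgebroid n m E) := ∀ w : TotalSpace (Fib m) E, A.Prol w

/-- `X` is smooth on `E∖{0}`, i.e. it represents an element of `Γ(𝒯E∖{0})`: both components
`w ↦ u(w) ∈ E` and `w ↦ v(w) ∈ T_wE` of `X = (u, v)` are smooth. -/
def IsSmooth (A : LieAlgebroid n m E) (X : A.Sec) : Prop :=
  ContMDiffOn (totModel n m) (totModel n m) ∞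
      (fun w => (⟨w.proj, (X w).1.1⟩ : TotalSpace (Fib m) E)) (slit m E) ∧
    ContMDiffOn (totModel n m) (totModel n m).tangent ∞
      (fun w => (⟨w, (X w).1.2⟩ : TangentBundle (totModel n m) (TotalSpace (Fib m) E)))
      (slit m E)

/-- The derivative `X(f) = σ¹(X) f` of a function on `E` along a section of `𝒯E`. -/
def along (A : LieAlgebroid n m E) (X : A.Sec) (f : TotalSpace (Fib m) E → ℝ) :
    TotalSpace (Fib m) E → ℝ :=
  fun w => mvfderiv (totModel n m) f w (X w).1.2

/-- The local frame of `E` near `x` given by the preferred trivialization at `x`. -/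
def frameAt (m : ℕ) {M : Type*} [TopologicalSpace M] (E : M → Type*)
    [TopologicalSpace (TotalSpace (Fib m) E)]
    [∀ x, AddCommGroup (E x)] [∀ x, Module ℝ (E x)] [∀ x, TopologicalSpace (E x)]
    [FiberBundle (Fib m) E] [VectorBundle ℝ (Fib m) E] (x : M) (i : Fin m) : ∀ y : M, E y :=
  (trivializationAt (Fib m) E x).localFrame (EuclideanSpace.basisFun (Fin m) ℝ).toBasis i

/-- The coefficients of elements of `E` in the frame `frameAt m E x`. -/
def frameCoeff (m : ℕ) {M : Type*} [TopologicalSpace M] (E : M → Type*)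
    [TopologicalSpace (TotalSpace (Fib m) E)]
    [∀ x, AddCommGroup (E x)] [∀ x, Module ℝ (E x)] [∀ x, TopologicalSpace (E x)]
    [FiberBundle (Fib m) E] [VectorBundle ℝ (Fib m) E] (x : M) (i : Fin m)
    (w : TotalSpace (Fib m) E) : ℝ :=
  (trivializationAt (Fib m) E x w).2 i

/-- The `E`-component of the bracket of two sections of `𝒯E`: if `X = (X^α s_α, v)` and
`Y = (Y^α s_α, v')` near `w`, with `{s_α}` a local frame of `E` near `π(w)`, it is
`(v(Y^γ) - v'(X^γ) + X^α Y^β L_{αβ}^γ) s_γ` at `w`. -/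
def lieFst (A : LieAlgebroid n m E) (X Y : A.Sec) (w : TotalSpace (Fib m) E) : E w.proj :=
  (∑ i, (A.along X (fun w' => frameCoeff m E w.proj i ⟨w'.proj, (Y w').1.1⟩) w
      - A.along Y (fun w' => frameCoeff m E w.proj i ⟨w'.proj, (X w').1.1⟩) w) •
        frameAt m E w.proj i w.proj)
    + ∑ i, ∑ j, (frameCoeff m E w.proj i ⟨w.proj, (X w).1.1⟩
        * frameCoeff m E w.proj j ⟨w.proj, (Y w).1.1⟩) •
        A.localBracket (frameAt m E w.proj i) (frameAt m E w.proj j) w.proj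

/-- The `TE`-component of the bracket of two sections of `𝒯E`. -/
def lieSnd (A : LieAlgebroid n m E) (X Y : A.Sec) (w : TotalSpace (Fib m) E) :
    TangentSpace (totModel n m) w :=
  VectorField.mlieBracket (totModel n m) (fun w' => (X w').1.2) (fun w' => (Y w').1.2) w

/-- The vertical lift `E_x → T_w(E_x) ⊆ T_wE`, `a ↦ d/dt (w + t a)` at `t = 0`. -/
def vlift (w : TotalSpace (Fib m) E) (a : E w.proj) : TangentSpace (totModel n m) w :=
  mfderiv 𝓘(ℝ, ℝ) (totModel n m)
    (fun t : ℝ => (⟨w.proj, w.2 + t • a⟩ : TotalSpace (Fib m) E)) 0 (1 : ℝ)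


lemma contMDiff_fibre_line (x : M) (a b : E x) :
    ContMDiff 𝓘(ℝ, ℝ) (totModel n m) ∞
      (fun t : ℝ => (⟨x, a + t • b⟩ : TotalSpace (Fib m) E)) := by
  intro t
  rw [contMDiffAt_totalSpace]
  refine ⟨contMDiffAt_const, ?_⟩
  set e := trivializationAt (Fib m) E x
  have hx : x ∈ e.baseSet := FiberBundle.mem_baseSet_trivializationAt' x
  have h : (fun t : ℝ => (e ⟨x, a + t • b⟩).2)
      = fun t : ℝ => e.linearEquivAt ℝ x hx a + t • e.linearEquivAt ℝ x hx b := by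
    funext t
    rw [← map_smul, ← map_add]
    rfl
  change ContMDiffAt 𝓘(ℝ, ℝ) 𝓘(ℝ, Fib m) ∞ (fun t : ℝ => (e ⟨x, a + t • b⟩).2) t
  rw [h]
  exact contMDiffAt_const.add (contMDiffAt_id.smul contMDiffAt_const)

/-- Chain rule for a map `c` into `E` through `w` and the projection `π`. -/
lemma mfderiv_proj_comp {V : Type*} [NormedAddCommGroup V] [NormedSpace ℝ V]
    {H : Type*} [TopologicalSpace H] {I : ModelWithCorners ℝ V H}
    {B : Type*} [TopologicalSpace B] [ChartedSpace H B]
    (w : TotalSpace (Fib m) E) (c : B → TotalSpace (Fib m) E) (z : B)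
    (hc : MDifferentiableAt I (totModel n m) c z) (hw : c z = w)
    (ξ : TangentSpace I z) :
    mfderiv (totModel n m) (𝓡 n) (TotalSpace.proj : TotalSpace (Fib m) E → M) w
        (mfderiv I (totModel n m) c z ξ : TangentSpace (totModel n m) w)
      = mfderiv I (𝓡 n) (fun y => (c y).proj) z ξ := by
  subst hw
  have hp : MDifferentiableAt (totModel n m) (𝓡 n)
      (TotalSpace.proj : TotalSpace (Fib m) E → M) (c z) :=
    (contMDiff_proj E (n := ∞) (IB := 𝓡 n) (F := Fib m) (c z)).mdifferentiableAt (by simp)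
  have := mfderiv_comp z hp hc
  exact (congrArg (fun L => L ξ) this).symm

lemma mfderiv_proj_vlift (w : TotalSpace (Fib m) E) (a : E w.proj) :
    mfderiv (totModel n m) (𝓡 n) (TotalSpace.proj : TotalSpace (Fib m) E → M) w
      (vlift (n := n) w a) = 0 := by
  have h := mfderiv_proj_comp (n := n) w
    (fun t : ℝ => (⟨w.proj, w.2 + t • a⟩ : TotalSpace (Fib m) E)) 0
    ((contMDiff_fibre_line w.proj w.2 a 0).mdifferentiableAt (by simp)) (by simp) (1 : ℝ)
  refine h.trans ?_
  change mfderiv 𝓘(ℝ, ℝ) (𝓡 n) (fun _ : ℝ => w.proj) 0 (1 : ℝ) = 0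
  rw [mfderiv_const]
  rfl

lemma vlift_mem (A : LieAlgebroid n m E) (w : TotalSpace (Fib m) E) (a : E w.proj) :
    ((0 : E w.proj), (vlift w a : TangentSpace (totModel n m) w)) ∈ A.Prol w := by
  change A.anchor w.proj 0 = mfderiv (totModel n m) (𝓡 n)
    (TotalSpace.proj : TotalSpace (Fib m) E → M) w (vlift w a)
  rw [map_zero, mfderiv_proj_vlift]

/-- The Euler section `ℂ(w) = (0, w^v_w)`. -/
def euler (A : LieAlgebroid n m E) : A.Sec :=
  fun w => ⟨(0, vlift w w.2), A.vlift_mem w w.2⟩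

/-- The tangent structure (vertical endomorphism) `J(u, v) = (0, u^v_w)` on `𝒯_wE`. -/
def J (A : LieAlgebroid n m E) {w : TotalSpace (Fib m) E} (p : A.Prol w) : A.Prol w :=
  ⟨(0, vlift w p.1.1), A.vlift_mem w p.1.1⟩

/-- `J` acting on sections. -/
def JSec (A : LieAlgebroid n m E) (X : A.Sec) : A.Sec := fun w => A.J (X w)

/-! ### Local coordinates -/

/-- The fibre coordinate `y^α` of `E` over `U` defined by a local frame `{s_α}` over `U`. -/
def yCoord {s : Fin m → ∀ x : M, E x} {U : Set M}
    (hs : IsLocalFrameOn (𝓡 n) (Fib m) ∞ s U) (α : Fin m) (w : TotalSpace (Fib m) E) : ℝ :=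
  hs.coeff α w.proj w.2

/-- The local section of `E` with constant coordinates `y^γ(w)` in the frame `{s_α}`. -/
def constSec {s : Fin m → ∀ x : M, E x} {U : Set M}
    (hs : IsLocalFrameOn (𝓡 n) (Fib m) ∞ s U) (w : TotalSpace (Fib m) E) (x : M) :
    TotalSpace (Fib m) E :=
  ⟨x, ∑ γ, yCoord hs γ w • s γ x⟩

/-- The tangent vector `σ_α^i ∂/∂x^i` at `w`, where `∂/∂x^i` is taken with all the `y^γ` fixed:
the image of `σ(s_α)` under the differential of the local section with constant `y^γ`. -/
def xLift (A : LieAlgebroid n m E) {s : Fin m → ∀ x : M, E x} {U : Set M}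
    (hs : IsLocalFrameOn (𝓡 n) (Fib m) ∞ s U) (α : Fin m) (w : TotalSpace (Fib m) E) :
    TangentSpace (totModel n m) w :=
  mfderiv (𝓡 n) (totModel n m) (constSec hs w) w.proj (A.anchor w.proj (s α w.proj))

lemma xLift_mem (A : LieAlgebroid n m E) {s : Fin m → ∀ x : M, E x} {U : Set M}
    (hU : IsOpen U) (hs : IsLocalFrameOn (𝓡 n) (Fib m) ∞ s U) (α : Fin m)
    (w : TotalSpace (Fib m) E) (hw : w.proj ∈ U) :
    (s α w.proj, A.xLift hs α w) ∈ A.Prol w := by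
  have hsm : ContMDiffAt (𝓡 n) (totModel n m) ∞ (constSec hs w) w.proj := by
    refine ContMDiffAt.sum_section (V := E) (F := Fib m) (t := fun γ x => yCoord hs γ w • s γ x)
      fun γ _ => ?_
    exact (hs.contMDiffAt hU hw γ).const_smul_section
  have hw' : constSec hs w w.proj = w := by
    classical
    have := hs.coeff_sum_eq (fun x => if h : x = w.proj then h ▸ w.2 else 0) hw
    simp only [dite_true] at this
    conv_rhs => rw [show w = ⟨w.proj, w.2⟩ from rfl, this]
    rfl
  have h := mfderiv_proj_comp (n := n) w (constSec hs w) w.proj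
    (hsm.mdifferentiableAt (by simp)) hw' (A.anchor w.proj (s α w.proj))
  change A.anchor w.proj (s α w.proj) = mfderiv (totModel n m) (𝓡 n)
    (TotalSpace.proj : TotalSpace (Fib m) E → M) w (A.xLift hs α w)
  refine Eq.symm (h.trans ?_)
  change mfderiv (𝓡 n) (𝓡 n) (fun y : M => y) w.proj _ = _
  erw [mfderiv_id]
  rfl

/-- The element `𝒳_α(w) = (s_α(π(w)), σ_α^i ∂/∂x^i)` of the local basis of `𝒯E`. -/
def basisX (A : LieAlgebroid n m E) {s : Fin m → ∀ x : M, E x} {U : Set M}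
    (hU : IsOpen U) (hs : IsLocalFrameOn (𝓡 n) (Fib m) ∞ s U) (α : Fin m)
    (w : TotalSpace (Fib m) E) (hw : w.proj ∈ U) : A.Prol w :=
  ⟨(s α w.proj, A.xLift hs α w), A.xLift_mem hU hs α w hw⟩

/-- The partial derivative `∂f/∂y^α` of a function on `E`. -/
def partialY {M : Type*} {E : M → Type*} [∀ x, AddCommGroup (E x)] [∀ x, Module ℝ (E x)]
    (s : Fin m → ∀ x : M, E x) (α : Fin m) (f : TotalSpace (Fib m) E → ℝ)
    (w : TotalSpace (Fib m) E) : ℝ :=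
  deriv (fun t : ℝ => f ⟨w.proj, w.2 + t • s α w.proj⟩) 0

/-- The structure functions `L_{αβ}^γ`, defined by `[s_α, s_β] = L_{αβ}^γ s_γ`. -/
def structFun (A : LieAlgebroid n m E) {s : Fin m → ∀ x : M, E x} {U : Set M}
    (hs : IsLocalFrameOn (𝓡 n) (Fib m) ∞ s U) (α β γ : Fin m) (x : M) : ℝ :=
  hs.coeff γ x (A.localBracket (s α) (s β) x)

/-- The component `S^β` of a semispray `S = y^α 𝒳_α + S^α 𝒱_α`. Since `𝒳_α(y^β) = 0` and
`𝒱_α(y^β) = δ_α^β`, it is `S(y^β)`. -/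
def semisprayCoeff (A : LieAlgebroid n m E) (S : A.Sec) {s : Fin m → ∀ x : M, E x} {U : Set M}
    (hs : IsLocalFrameOn (𝓡 n) (Fib m) ∞ s U) (β : Fin m) : TotalSpace (Fib m) E → ℝ :=
  A.along S (yCoord hs β)

/-! ### The Lie bracket on `𝒯E` -/


lemma exists_global_extension [T2Space M] {s : ∀ y : M, E y} {U : Set M} {x : M}
    (hU : IsOpen U) (hx : x ∈ U)
    (hs : ContMDiffOn (𝓡 n) (totModel n m) ∞
      (fun y => (⟨y, s y⟩ : TotalSpace (Fib m) E)) U) :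
    ∃ σ : Cₛ^∞⟮𝓡 n; Fib m, E⟯, ∀ᶠ y in 𝓝 x, σ y = s y := by
  obtain ⟨b, -, hb⟩ := (SmoothBumpFunction.nhds_basis_tsupport (I := 𝓡 n) x).mem_iff.1
    (hU.mem_nhds hx)
  refine ⟨⟨_, ContMDiffOn.smul_section_of_tsupport (ψ := b) (s := s) (u := U)
    b.contMDiff.contMDiffOn hU hb hs⟩, ?_⟩
  filter_upwards [b.eventuallyEq_one] with y hy
  change b y • s y = s y
  rw [hy, Pi.one_apply, one_smul]

lemma anchor_localBracket [T2Space M] (A : LieAlgebroid n m E) {s t : ∀ y : M, E y} {U : Set M}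
    {x : M} (hU : IsOpen U) (hx : x ∈ U)
    (hs : ContMDiffOn (𝓡 n) (totModel n m) ∞ (fun y => (⟨y, s y⟩ : TotalSpace (Fib m) E)) U)
    (ht : ContMDiffOn (𝓡 n) (totModel n m) ∞ (fun y => (⟨y, t y⟩ : TotalSpace (Fib m) E)) U) :
    A.anchor x (A.localBracket s t x) = VectorField.mlieBracket (𝓡 n)
      (fun y => A.anchor y (s y)) (fun y => A.anchor y (t y)) x := by
  obtain ⟨σ, hσ⟩ := exists_global_extension (n := n) hU hx hs
  obtain ⟨τ, hτ⟩ := exists_global_extension (n := n) hU hx ht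
  have h : ∃ p : Cₛ^∞⟮𝓡 n; Fib m, E⟯ × Cₛ^∞⟮𝓡 n; Fib m, E⟯,
      (∀ᶠ y in 𝓝 x, p.1 y = s y) ∧ (∀ᶠ y in 𝓝 x, p.2 y = t y) := ⟨(σ, τ), hσ, hτ⟩
  rw [localBracket, dif_pos h, A.anchor_bracket]
  apply Filter.EventuallyEq.mlieBracket_vectorField_eq
  · filter_upwards [h.choose_spec.1] with y hy
    rw [hy]
  · filter_upwards [h.choose_spec.2] with y hy
    rw [hy]

lemma eq_of_coord_eq {x : M} {ξ η : TangentSpace (𝓡 n) x}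
    (h : ∀ k : Fin n, mvfderiv (𝓡 n) (fun y => extChartAt (𝓡 n) x y k) x ξ
      = mvfderiv (𝓡 n) (fun y => extChartAt (𝓡 n) x y k) x η) : ξ = η := by
  have hinv := isInvertible_mfderiv_extChartAt (I := 𝓡 n) (mem_extChartAt_source (I := 𝓡 n) x)
  apply hinv.injective
  have hd : MDifferentiableAt (𝓡 n) 𝓘(ℝ, EuclideanSpace ℝ (Fin n)) (extChartAt (𝓡 n) x) x :=
    mdifferentiableAt_extChartAt (ChartedSpace.mem_chart_source x)
  have hk : ∀ (k : Fin n) (ζ : TangentSpace (𝓡 n) x),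
      mvfderiv (𝓡 n) (fun y => extChartAt (𝓡 n) x y k) x ζ
        = (show EuclideanSpace ℝ (Fin n) from
            mfderiv (𝓡 n) 𝓘(ℝ, EuclideanSpace ℝ (Fin n)) (extChartAt (𝓡 n) x) x ζ) k := by
    intro k ζ
    have hp : MDifferentiableAt 𝓘(ℝ, EuclideanSpace ℝ (Fin n)) 𝓘(ℝ, ℝ)
        (EuclideanSpace.proj k : EuclideanSpace ℝ (Fin n) →L[ℝ] ℝ) (extChartAt (𝓡 n) x x) :=
      (ContinuousLinearMap.differentiableAt _).mdifferentiableAt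
    have := mvfderiv_comp_apply x hp hd ζ
    refine this.trans ?_
    rw [mvfderiv, mfderiv_eq_fderiv]
    erw [ContinuousLinearMap.fderiv]
    rfl
  refine PiLp.ext fun k => ?_
  have := h k
  rw [hk, hk] at this
  exact this

lemma slit_mem_nhds {w : TotalSpace (Fib m) E} (hw : w ∈ slit m E) : slit m E ∈ 𝓝 w := by
  set e := trivializationAt (Fib m) E w.proj
  have hwe : w ∈ e.source := FiberBundle.mem_trivializationAt_proj_source
  have hlin : ∀ p ∈ e.source, (p ∈ slit m E ↔ (e p).2 ≠ 0) := by
    intro p hp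
    have hb : p.proj ∈ e.baseSet := e.mem_source.1 hp
    have : (e p).2 = e.linearEquivAt ℝ p.proj hb p.2 := rfl
    rw [show p ∈ slit m E ↔ p.2 ≠ 0 from Iff.rfl, this, ne_eq, ne_eq,
      LinearEquiv.map_eq_zero_iff]
  have hc : ContinuousAt (fun p => (e p).2) w :=
    continuousAt_snd.comp (e.continuousAt hwe)
  have := hc.eventually_ne ((hlin w hwe).1 hw)
  filter_upwards [this, e.open_source.mem_nhds hwe] with p hp hpe
  exact (hlin p hpe).2 hp

lemma frameAt_smooth (x : M) (i : Fin m) :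
    ContMDiffOn (𝓡 n) (totModel n m) ∞
      (fun y => (⟨y, frameAt m E x i y⟩ : TotalSpace (Fib m) E))
      (trivializationAt (Fib m) E x).baseSet :=
  (trivializationAt (Fib m) E x).contMDiffOn_localFrame_baseSet (I := 𝓡 n) ∞ _ i

lemma sum_frameCoeff {x : M} {p : TotalSpace (Fib m) E}
    (hp : p.proj ∈ (trivializationAt (Fib m) E x).baseSet) :
    p.2 = ∑ i, frameCoeff m E x i p • frameAt m E x i p.proj := by
  set e := trivializationAt (Fib m) E x
  have h := ((e.basisAt (EuclideanSpace.basisFun (Fin m) ℝ).toBasis hp).sum_repr p.2).symm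
  refine h.trans (Finset.sum_congr rfl fun i _ => ?_)
  rw [frameAt, e.localFrame_apply_of_mem_baseSet _ hp]
  congr 1

/-- Product rule for a finite sum of products. -/
lemma mvfderiv_sum_mul {ι : Type*} (t : Finset ι) (a b : ι → TotalSpace (Fib m) E → ℝ)
    (w : TotalSpace (Fib m) E)
    (ha : ∀ i, MDifferentiableAt (totModel n m) 𝓘(ℝ, ℝ) (a i) w)
    (hb : ∀ i, MDifferentiableAt (totModel n m) 𝓘(ℝ, ℝ) (b i) w) :
    MDifferentiableAt (totModel n m) 𝓘(ℝ, ℝ) (fun w' => ∑ i ∈ t, a i w' * b i w') w ∧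
    ∀ ξ : TangentSpace (totModel n m) w,
      mvfderiv (totModel n m) (fun w' => ∑ i ∈ t, a i w' * b i w') w ξ
        = ∑ i ∈ t, (a i w * mvfderiv (totModel n m) (b i) w ξ
          + b i w * mvfderiv (totModel n m) (a i) w ξ) := by
  classical
  induction t using Finset.induction_on with
  | empty =>
    refine ⟨by simpa using mdifferentiableAt_const, fun ξ => ?_⟩
    simp only [Finset.sum_empty]
    rw [mvfderiv_const]
    rfl
  | insert j t hj ih =>
    have hp : MDifferentiableAt (totModel n m) 𝓘(ℝ, ℝ) (fun w' => a j w' * b j w') w :=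
      (ha j).mul (hb j)
    refine ⟨?_, fun ξ => ?_⟩
    · simp only [Finset.sum_insert hj]
      exact hp.add ih.1
    · simp only [Finset.sum_insert hj]
      rw [mvfderiv_fun_add hp ih.1, add_apply, ih.2]
      congr 1
      have := mvfderiv_fun_mul (ha j) (hb j)
      refine (congrArg (fun L => L ξ) this).trans ?_
      simp

lemma sum_aux {ι : Type*} [Fintype ι] (a b c p q : ι → ℝ) (D : ι → ι → ℝ) :
    (∑ i, (p i - q i) * c i) + ∑ i, ∑ j, a i * b j * (D j i - D i j)
      = (∑ i, (b i * ∑ j, a j * D i j + c i * p i))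
        - ∑ i, (a i * ∑ j, b j * D i j + c i * q i) := by
  have h1 : ∑ i, ∑ j, a i * b j * (D j i - D i j)
      = (∑ i, b i * ∑ j, a j * D i j) - ∑ i, a i * ∑ j, b j * D i j := by
    simp only [mul_sub, Finset.sum_sub_distrib, Finset.mul_sum]
    congr 1
    · rw [Finset.sum_comm]
      exact Finset.sum_congr rfl fun i _ => Finset.sum_congr rfl fun j _ => by ring
    · exact Finset.sum_congr rfl fun i _ => Finset.sum_congr rfl fun j _ => by ring
  have h2 : ∑ i, (p i - q i) * c i = (∑ i, c i * p i) - ∑ i, c i * q i := by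
    rw [← Finset.sum_sub_distrib]
    exact Finset.sum_congr rfl fun i _ => by ring
  rw [h1, h2, Finset.sum_add_distrib, Finset.sum_add_distrib]
  ring

set_option maxHeartbeats 1000000 in
/-- The bracket of two smooth sections of `𝒯E` is a section of `𝒯E`. -/
lemma lie_mem [T2Space M] (A : LieAlgebroid n m E) {X Y : A.Sec} (hX : A.IsSmooth X)
    (hY : A.IsSmooth Y) {w : TotalSpace (Fib m) E} (hw : w ∈ slit m E) :
    (A.lieFst X Y w, A.lieSnd X Y w) ∈ A.Prol w := by
  set x := w.proj with hx
  set e := trivializationAt (Fib m) E x with he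
  have hxe : x ∈ e.baseSet := FiberBundle.mem_baseSet_trivializationAt' x
  change A.anchor w.proj (A.lieFst X Y w) = mfderiv (totModel n m) (𝓡 n)
    (TotalSpace.proj : TotalSpace (Fib m) E → M) w (A.lieSnd X Y w)
  apply eq_of_coord_eq
  intro k
  set f : M → ℝ := fun y => extChartAt (𝓡 n) x y k with hf
  set U : Set M := (chartAt (EuclideanSpace ℝ (Fin n)) x).source with hUdef
  have hU : IsOpen U := (chartAt (EuclideanSpace ℝ (Fin n)) x).open_source
  have hxU : x ∈ U := mem_chart_source _ x
  have hfs : ContMDiffOn (𝓡 n) 𝓘(ℝ, ℝ) ∞ f U := by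
    have h1 : ContMDiff 𝓘(ℝ, EuclideanSpace ℝ (Fin n)) 𝓘(ℝ, ℝ) ∞
        (EuclideanSpace.proj k : EuclideanSpace ℝ (Fin n) →L[ℝ] ℝ) :=
      (ContinuousLinearMap.contDiff _).contMDiff
    exact h1.comp_contMDiffOn (contMDiffOn_extChartAt (x := x))
  -- the functions `σ(s_i) f`
  set g : Fin m → M → ℝ := fun i y => mvfderiv (𝓡 n) f y (A.anchor y (frameAt m E x i y)) with hg
  have hs : ∀ i, ContMDiffAt (𝓡 n) (𝓡 n).tangent ∞
      (fun y => (⟨y, A.anchor y (frameAt m E x i y)⟩ : TangentBundle (𝓡 n) M)) x := by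
    intro i
    exact A.anchor_smooth.contMDiffAt.comp x
      ((frameAt_smooth x i).contMDiffAt (e.open_baseSet.mem_nhds hxe))
  have hgs : ∀ i, MDifferentiableAt (𝓡 n) 𝓘(ℝ, ℝ) (g i) x := fun i =>
    (contMDiffAt_mvfderiv_apply hU hxU hfs (hs i)).mdifferentiableAt (by simp)
  -- coefficients of sections
  have hπ : ∀ p : TotalSpace (Fib m) E, MDifferentiableAt (totModel n m) (𝓡 n)
      (TotalSpace.proj : TotalSpace (Fib m) E → M) p := fun p =>
    (contMDiff_proj E (n := ∞) (IB := 𝓡 n) (F := Fib m) p).mdifferentiableAt (by simp)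
  have hco : ∀ {Z : A.Sec}, A.IsSmooth Z → ∀ i, MDifferentiableAt (totModel n m) 𝓘(ℝ, ℝ)
      (fun w' => frameCoeff m E x i ⟨w'.proj, (Z w').1.1⟩) w := by
    intro Z hZ i
    have h1 := (hZ.1.contMDiffAt (slit_mem_nhds hw))
    rw [contMDiffAt_totalSpace] at h1
    have h2 : ContMDiff 𝓘(ℝ, Fib m) 𝓘(ℝ, ℝ) ∞ (EuclideanSpace.proj i : Fib m →L[ℝ] ℝ) :=
      (ContinuousLinearMap.contDiff _).contMDiff
    exact (h2.contMDiffAt.comp w h1.2).mdifferentiableAt (by simp)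
  have hexp : ∀ (Z : A.Sec) (w' : TotalSpace (Fib m) E), w'.proj ∈ e.baseSet →
      ∀ φ : M → ℝ, mvfderiv (𝓡 n) φ w'.proj (mfderiv (totModel n m) (𝓡 n)
        (TotalSpace.proj : TotalSpace (Fib m) E → M) w' (Z w').1.2)
        = ∑ i, frameCoeff m E x i ⟨w'.proj, (Z w').1.1⟩
          * mvfderiv (𝓡 n) φ w'.proj (A.anchor w'.proj (frameAt m E x i w'.proj)) := by
    intro Z w' hw' φ
    have hz : A.anchor w'.proj (Z w').1.1 = mfderiv (totModel n m) (𝓡 n)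
      (TotalSpace.proj : TotalSpace (Fib m) E → M) w' (Z w').1.2 := (Z w').2
    rw [← hz]
    conv_lhs => rw [show (Z w').1.1 = _ from
      sum_frameCoeff (x := x) (p := ⟨w'.proj, (Z w').1.1⟩) hw']
    simp only [map_sum, map_smul, smul_eq_mul]
  set F : TotalSpace (Fib m) E → ℝ := fun w' => f w'.proj with hF
  have hFs : ContMDiffOn (totModel n m) 𝓘(ℝ, ℝ) ∞ F (TotalSpace.proj ⁻¹' U) :=
    hfs.comp (contMDiff_proj E).contMDiffOn (fun _ h => h)
  have hUo : IsOpen ((TotalSpace.proj : TotalSpace (Fib m) E → M) ⁻¹' U) :=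
    hU.preimage (FiberBundle.continuous_proj (Fib m) E)
  have hbo : IsOpen ((TotalSpace.proj : TotalSpace (Fib m) E → M) ⁻¹' e.baseSet) :=
    e.open_baseSet.preimage (FiberBundle.continuous_proj (Fib m) E)
  have hFd : ∀ w' : TotalSpace (Fib m) E, w'.proj ∈ U → ∀ ξ : TangentSpace (totModel n m) w',
      mvfderiv (totModel n m) F w' ξ = mvfderiv (𝓡 n) f w'.proj (mfderiv (totModel n m) (𝓡 n)
        (TotalSpace.proj : TotalSpace (Fib m) E → M) w' ξ) := by
    intro w' hw' ξ
    exact mvfderiv_comp_apply w' ((hfs.contMDiffAt (hU.mem_nhds hw')).mdifferentiableAt (by simp))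
      (hπ w') ξ
  have hder : ∀ {Z : A.Sec}, A.IsSmooth Z → ∀ ξ : TangentSpace (totModel n m) w,
      mvfderiv (totModel n m) (fun w' => mvfderiv (totModel n m) F w' (Z w').1.2) w ξ
        = ∑ i, (frameCoeff m E x i ⟨w.proj, (Z w).1.1⟩
            * mvfderiv (𝓡 n) (g i) x (mfderiv (totModel n m) (𝓡 n)
              (TotalSpace.proj : TotalSpace (Fib m) E → M) w ξ)
          + g i x * mvfderiv (totModel n m)
            (fun w' => frameCoeff m E x i ⟨w'.proj, (Z w').1.1⟩) w ξ) := by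
    intro Z hZ ξ
    have hev : (fun w' => mvfderiv (totModel n m) F w' (Z w').1.2) =ᶠ[𝓝 w]
        fun w' => ∑ i, frameCoeff m E x i ⟨w'.proj, (Z w').1.1⟩ * g i w'.proj := by
      filter_upwards [hUo.mem_nhds (show w ∈ _ from hxU), hbo.mem_nhds (show w ∈ _ from hxe)]
        with w' h1 h2
      rw [hFd w' h1, hexp Z w' h2 f]
    have e1 : mvfderiv (totModel n m) (fun w' => mvfderiv (totModel n m) F w' (Z w').1.2) w ξ
        = mvfderiv (totModel n m)
          (fun w' => ∑ i, frameCoeff m E x i ⟨w'.proj, (Z w').1.1⟩ * g i w'.proj) w ξ :=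
      congrArg (fun L : TangentSpace (totModel n m) w →L[ℝ] ℝ => L ξ) hev.mfderiv_eq
    rw [e1, (mvfderiv_sum_mul Finset.univ
      (fun i w' => frameCoeff m E x i ⟨w'.proj, (Z w').1.1⟩)
      (fun i w' => g i w'.proj) w (hco hZ) (fun i => (hgs i).comp w (hπ w))).2 ξ]
    refine Finset.sum_congr rfl fun i _ => ?_
    congr 2
    exact mvfderiv_comp_apply w (hgs i) (hπ w) ξ
  rw [← hFd w hxU]
  have hbr := mvfderiv_mlieBracket hUo (show w ∈ _ from hxU) hFs
    (hX.2.contMDiffAt (slit_mem_nhds hw)) (hY.2.contMDiffAt (slit_mem_nhds hw))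
  change _ = mvfderiv (totModel n m) F w (VectorField.mlieBracket _ _ _ w)
  rw [hbr, hder hY, hder hX]
  have hloc : ∀ i j, mvfderiv (𝓡 n) f x
      (A.anchor x (A.localBracket (frameAt m E x i) (frameAt m E x j) x))
      = mvfderiv (𝓡 n) (g j) x (A.anchor x (frameAt m E x i x))
        - mvfderiv (𝓡 n) (g i) x (A.anchor x (frameAt m E x j x)) := by
    intro i j
    rw [A.anchor_localBracket e.open_baseSet hxe (frameAt_smooth x i) (frameAt_smooth x j)]
    exact mvfderiv_mlieBracket hU hxU hfs (hs i) (hs j)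
  have hlhs : mvfderiv (𝓡 n) f x (A.anchor x (A.lieFst X Y w))
      = (∑ i, (A.along X (fun w' => frameCoeff m E x i ⟨w'.proj, (Y w').1.1⟩) w
          - A.along Y (fun w' => frameCoeff m E x i ⟨w'.proj, (X w').1.1⟩) w) * g i x)
        + ∑ i, ∑ j, (frameCoeff m E x i ⟨w.proj, (X w).1.1⟩
          * frameCoeff m E x j ⟨w.proj, (Y w).1.1⟩) *
            (mvfderiv (𝓡 n) (g j) x (A.anchor x (frameAt m E x i x))
              - mvfderiv (𝓡 n) (g i) x (A.anchor x (frameAt m E x j x))) := by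
    simp only [← hloc, lieFst, map_add, map_sum, map_smul, smul_eq_mul]
    rfl
  refine hlhs.trans ?_
  have hX' := fun i => hexp X w hxe (g i)
  have hY' := fun i => hexp Y w hxe (g i)
  refine (sum_aux (fun i => frameCoeff m E x i ⟨w.proj, (X w).1.1⟩)
    (fun i => frameCoeff m E x i ⟨w.proj, (Y w).1.1⟩) (fun i => g i x) _ _
    (fun i j => mvfderiv (𝓡 n) (g i) x (A.anchor x (frameAt m E x j x)))).trans ?_
  refine congrArg₂ _ (Finset.sum_congr rfl fun i _ => ?_) (Finset.sum_congr rfl fun i _ => ?_)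
  · exact congrArg (fun z => _ * z + _) (hX' i).symm
  · exact congrArg (fun z => _ * z + _) (hY' i).symm

open Classical in
/-- The Lie bracket `[X, Y]_{𝒯E}` of the Lie algebroid `𝒯E → E`. The pair of its components lies
in `𝒯_wE` whenever `X`, `Y` are smooth and `w ≠ 0`, by `lie_mem`. -/
def lie (A : LieAlgebroid n m E) (X Y : A.Sec) : A.Sec := fun w =>
  if h : (A.lieFst X Y w, A.lieSnd X Y w) ∈ A.Prol w then ⟨_, h⟩ else 0

/-! ### Semisprays, nonlinear connections, dynamical covariant derivative -/

/-- `S` is a semispray: a smooth section of `𝒯E` with `J(S) = ℂ` (on `E∖{0}`). -/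
def IsSemispray (A : LieAlgebroid n m E) (S : A.Sec) : Prop :=
  A.IsSmooth S ∧ ∀ w ∈ slit m E, A.J (S w) = A.euler w

/-- A nonlinear connection: a bundle morphism `𝒩 : 𝒯E → 𝒯E`, smooth on `𝒯E∖{0}`, with
`𝒩² = Id` and `V𝒯E = ker (Id + 𝒩)`, where `V𝒯E = {(u, v) | u = 0}`. -/
structure NonlinearConnection (A : LieAlgebroid n m E) where
  /-- The action on the fibres. -/
  toFun : ∀ w : TotalSpace (Fib m) E, A.Prol w →ₗ[ℝ] A.Prol w
  smooth : ∀ X : A.Sec, A.IsSmooth X → A.IsSmooth (fun w => toFun w (X w))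
  sq : ∀ w ∈ slit m E, toFun w ∘ₗ toFun w = LinearMap.id
  mem_ker_iff : ∀ w ∈ slit m E, ∀ p : A.Prol w,
    p ∈ LinearMap.ker (LinearMap.id + toFun w) ↔ p.1.1 = 0

namespace NonlinearConnection

variable {A : LieAlgebroid n m E}

/-- The horizontal projector `h = (Id + 𝒩)/2`, acting on sections. -/
def h (N : A.NonlinearConnection) (X : A.Sec) : A.Sec :=
  fun w => (1 / 2 : ℝ) • (X w + N.toFun w (X w))

/-- The vertical projector `v = (Id - 𝒩)/2`, acting on sections. -/
def v (N : A.NonlinearConnection) (X : A.Sec) : A.Sec :=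
  fun w => (1 / 2 : ℝ) • (X w - N.toFun w (X w))

/-- The dynamical covariant derivative `∇ = h ∘ L_S ∘ h + v ∘ L_S ∘ v` on sections. -/
def nabla (N : A.NonlinearConnection) (S : A.Sec) (X : A.Sec) : A.Sec :=
  fun w => N.h (A.lie S (N.h X)) w + N.v (A.lie S (N.v X)) w

/-- The local coefficient `𝒩_α^β`, defined by `𝒩(𝒳_α) = 𝒳_α - 2 𝒩_α^β 𝒱_β`; since
`𝒳_α(y^β) = 0` and `𝒱_γ(y^β) = δ_γ^β`, it is `-1/2` times the derivative of `y^β` along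
`𝒩(𝒳_α)`. -/
def coeff (N : A.NonlinearConnection) {s : Fin m → ∀ x : M, E x} {U : Set M}
    (hU : IsOpen U) (hs : IsLocalFrameOn (𝓡 n) (Fib m) ∞ s U) (α β : Fin m)
    (w : TotalSpace (Fib m) E) (hw : w.proj ∈ U) : ℝ :=
  -(1 / 2) * mvfderiv (totModel n m) (yCoord hs β) w
    (N.toFun w (A.basisX hU hs α w hw)).1.2

/-- `∇J = 0`, where `∇J = ∇ ∘ J - J ∘ ∇`. -/
def NablaJZero (N : A.NonlinearConnection) (S : A.Sec) : Prop :=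
  ∀ X : A.Sec, A.IsSmooth X → ∀ w ∈ slit m E,
    N.nabla S (A.JSec X) w - A.JSec (N.nabla S X) w = 0

/-- `L_S J + 𝒩 = 0`, where `L_S J = L_S ∘ J - J ∘ L_S`. -/
def LieJAddZero (N : A.NonlinearConnection) (S : A.Sec) : Prop :=
  ∀ X : A.Sec, A.IsSmooth X → ∀ w ∈ slit m E,
    A.lie S (A.JSec X) w - A.JSec (A.lie S X) w + N.toFun w (X w) = 0

/-- `𝒩_α^β = 1/2 (-∂S^β/∂y^α + y^ε L_{αε}^β)` in all local coordinates. -/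
def LocalFormula (N : A.NonlinearConnection) (S : A.Sec) : Prop :=
  ∀ (U : Set M) (hU : IsOpen U) (s : Fin m → ∀ x : M, E x)
    (hs : IsLocalFrameOn (𝓡 n) (Fib m) ∞ s U) (α β : Fin m),
    ∀ w ∈ slit m E, ∀ hw : w.proj ∈ U,
      N.coeff hU hs α β w hw
        = 1 / 2 * (-partialY s α (A.semisprayCoeff S hs β) w
          + ∑ ε, yCoord hs ε w * A.structFun hs α ε β w.proj)

end NonlinearConnection

/-- The Newtonoid sections `𝔛_S = Ker (J ∘ L_S)`. -/
def newtonoid (A : LieAlgebroid n m E) (S : A.Sec) : Set A.Sec :=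
  {X | A.IsSmooth X ∧ ∀ w ∈ slit m E, A.J (A.lie S X w) = 0}

/-- The product `f * X = (Id + J ∘ L_S)(f X)`, which is `f X + f J[S, X] + S(f) J X`. -/
def star (A : LieAlgebroid n m E) (S : A.Sec) (f : TotalSpace (Fib m) E → ℝ) (X : A.Sec) :
    A.Sec :=
  fun w => f w • X w + A.J (A.lie S (fun w' => f w' • X w') w)

namespace NonlinearConnection

variable {A : LieAlgebroid n m E}

/-- `∇` restricts to a map `𝔛_S → 𝔛_S` which satisfies the Leibniz rule
`∇(f * X) = (∇f) * X + f * ∇X`, `∇f = S(f)`, for the product `*`. -/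
def RestrictsWithLeibniz (N : A.NonlinearConnection) (S : A.Sec) : Prop :=
  (∀ X ∈ A.newtonoid S, N.nabla S X ∈ A.newtonoid S) ∧
    ∀ f : TotalSpace (Fib m) E → ℝ, ContMDiffOn (totModel n m) 𝓘(ℝ, ℝ) ∞ f (slit m E) →
      ∀ X ∈ A.newtonoid S, ∀ w ∈ slit m E,
        N.nabla S (A.star S f X) w = A.star S (A.along S f) X w + A.star S f (N.nabla S X) w

end NonlinearConnection

end LieAlgebroid

end

noncomputable section

namespace LieAlgebroid

variable {n m : ℕ} {M : Type*} [TopologicalSpace M]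
  [ChartedSpace (EuclideanSpace ℝ (Fin n)) M] [IsManifold (𝓡 n) ∞ M]
  {E : M → Type*} [TopologicalSpace (TotalSpace (Fib m) E)]
  [∀ x, AddCommGroup (E x)] [∀ x, Module ℝ (E x)] [∀ x, TopologicalSpace (E x)]
  [FiberBundle (Fib m) E] [VectorBundle ℝ (Fib m) E]
  [ContMDiffVectorBundle ∞ (Fib m) E (𝓡 n)]

/-! ### Coordinates on the total space -/

/-! Everything is governed by T = L_S J + 𝒩, that is T X = [S, JX] - J[S, X] + 𝒩X (`lieJAdd`). One
identity about the bracket does the work: J[S, V] = -V for every vertical V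
(`IsSemispray.J_lie_vertical`). It holds because the coefficients of the E-component of a semispray
are the fibre coordinates y^α, so that the E-component of [S, V] is -V(y^α) s_α.

For any 𝒩 the projectors satisfy hJ = 0, vJ = J, Jh = J and Jv = 0. Hence ∇(JX) = v[S, JX] = [S, JX]
+ hX, while J∇X = J[S, hX] = J[S, X] + vX. Subtracting gives ∇J = T (`nabla_J_sub_J_nabla`), so (ii)
and (iii) are the same condition. Moreover T takes vertical values, and the β-th fibre coordinate of
T X is X^α(-∂S^β/∂y^α + y^ε L_{αε}^β - 2𝒩_α^β) (`along_lieJAdd_yCoord`); this is the equivalence of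
(iii) and (iv).

For Newtonoid X one has f * X = fX + S(f)JX. Expanding with the ordinary Leibniz rule of ∇, the
defect of the rule for * is S(f)(∇J)X = S(f) T X (`leibniz_defect`). If T = 0 the defect vanishes,
and ∇ preserves Newtonoid sections by another use of J[S, V] = -V (`nabla_mem_newtonoid`).
Conversely, (i) forces T X = 0 at every point where S(f) ≠ 0 for some f, that is where σ¹(S) ≠ 0.
Under the hypothesis such points are dense in E∖{0}, so T X = 0 by continuity for Newtonoid X. An
arbitrary X differs from the Newtonoid section X + J[S, X] by a vertical one, and T kills vertical
sections, so T = 0.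

Much of the length goes into the bracket itself. Its E-component at w is defined in the preferred
frame at π(w), which varies with w. Independence of the frame (`lieFst_frame`) is what makes the
bracket smooth and computable in the arbitrary coordinates of (iv). -/

lemma isOpen_proj_preimage {U : Set M} (hU : IsOpen U) :
    IsOpen ((TotalSpace.proj : TotalSpace (Fib m) E → M) ⁻¹' U) :=
  hU.preimage (FiberBundle.continuous_proj (Fib m) E)

lemma isOpen_slit : IsOpen (slit m E) :=
  isOpen_iff_mem_nhds.2 fun _ hw => slit_mem_nhds hw

lemma mdifferentiableAt_proj (w : TotalSpace (Fib m) E) :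
    MDifferentiableAt (totModel n m) (𝓡 n) (TotalSpace.proj : TotalSpace (Fib m) E → M) w :=
  (contMDiff_proj E (n := ∞) (IB := 𝓡 n) (F := Fib m) w).mdifferentiableAt (by simp)

lemma isLocalFrameOn_frameAt (x : M) :
    IsLocalFrameOn (𝓡 n) (Fib m) ∞ (frameAt m E x) (trivializationAt (Fib m) E x).baseSet :=
  (trivializationAt (Fib m) E x).isLocalFrameOn_localFrame_baseSet (𝓡 n) ∞
    (EuclideanSpace.basisFun (Fin m) ℝ).toBasis

lemma sum_coeff_smul {s : Fin m → ∀ x : M, E x} {U : Set M}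
    (hs : IsLocalFrameOn (𝓡 n) (Fib m) ∞ s U) {x : M} (hx : x ∈ U) (a : E x) :
    ∑ i, hs.coeff i x a • s i x = a := by
  classical
  -- `coeff_sum_eq` speaks of sections, so the vector a is extended by zero off x; the extension
  -- need not be continuous.
  have := hs.coeff_sum_eq (fun y => if h : y = x then h ▸ a else 0) hx
  simp only [dite_true] at this
  exact this.symm

lemma ext_coeff {s : Fin m → ∀ x : M, E x} {U : Set M}
    (hs : IsLocalFrameOn (𝓡 n) (Fib m) ∞ s U) {x : M} (hx : x ∈ U) {a b : E x}
    (h : ∀ i, hs.coeff i x a = hs.coeff i x b) : a = b := by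
  rw [← sum_coeff_smul hs hx a, ← sum_coeff_smul hs hx b]
  simp only [h]

lemma coeff_sum_smul {s : Fin m → ∀ x : M, E x} {U : Set M}
    (hs : IsLocalFrameOn (𝓡 n) (Fib m) ∞ s U) {x : M} (hx : x ∈ U) (c : Fin m → ℝ) (j : Fin m) :
    hs.coeff j x (∑ i, c i • s i x) = c j := by
  simp only [IsLocalFrameOn.coeff, hx, dite_true]
  rw [Module.Basis.coord_apply]
  have : ∑ i, c i • s i x = ∑ i, c i • hs.toBasisAt hx i := by simp
  rw [this, Module.Basis.repr_sum_self]

lemma coeff_self {s : Fin m → ∀ x : M, E x} {U : Set M}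
    (hs : IsLocalFrameOn (𝓡 n) (Fib m) ∞ s U) {x : M} (hx : x ∈ U) (i j : Fin m) :
    hs.coeff j x (s i x) = if j = i then 1 else 0 := by
  have := coeff_sum_smul hs hx (fun k => if k = i then 1 else 0) j
  simpa using this

lemma frameCoeff_eq_coeff {x : M} {p : TotalSpace (Fib m) E}
    (hp : p.proj ∈ (trivializationAt (Fib m) E x).baseSet) (i : Fin m) :
    frameCoeff m E x i p = (isLocalFrameOn_frameAt (n := n) x).coeff i p.proj p.2 := by
  conv_rhs => rw [sum_frameCoeff hp]
  rw [coeff_sum_smul _ hp]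

lemma contMDiffOn_frameCoeff (x : M) (i : Fin m) :
    ContMDiffOn (totModel n m) 𝓘(ℝ, ℝ) ∞ (frameCoeff m E x i)
      (TotalSpace.proj ⁻¹' (trivializationAt (Fib m) E x).baseSet) := by
  have h1 : ContMDiff 𝓘(ℝ, Fib m) 𝓘(ℝ, ℝ) ∞
      (EuclideanSpace.proj i : Fib m →L[ℝ] ℝ) := (ContinuousLinearMap.contDiff _).contMDiff
  have h2 := (trivializationAt (Fib m) E x).contMDiffOn (IB := 𝓡 n) (n := ∞)
  have h3 := h1.comp_contMDiffOn (contMDiff_snd.comp_contMDiffOn h2)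
  refine h3.mono fun p hp => ?_
  exact (trivializationAt (Fib m) E x).mem_source.2 hp

/-- The coefficients of elements of `E` in a smooth local frame are smooth functions on `E`. -/
lemma contMDiffOn_yCoord {s : Fin m → ∀ x : M, E x} {U : Set M} (hU : IsOpen U)
    (hs : IsLocalFrameOn (𝓡 n) (Fib m) ∞ s U) (α : Fin m) :
    ContMDiffOn (totModel n m) 𝓘(ℝ, ℝ) ∞ (yCoord hs α) (TotalSpace.proj ⁻¹' U) := by
  intro w hw
  have hw : w.proj ∈ U := hw
  refine ContMDiffAt.contMDiffWithinAt ?_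
  set e := trivializationAt (Fib m) E w.proj with he
  have hwe : w.proj ∈ e.baseSet := FiberBundle.mem_baseSet_trivializationAt' w.proj
  have hvec : ContMDiffAt (totModel n m) 𝓘(ℝ, Fib m) ∞ (fun p => (e p).2) w :=
    contMDiffAt_snd.comp w
      ((e.contMDiffOn (IB := 𝓡 n) (n := ∞)).contMDiffAt
        (e.open_source.mem_nhds (e.mem_source.2 hwe)))
  -- Q x is the matrix of the frame s read in the trivialization e. The coefficients of a vector are
  -- (Q x)⁻¹ applied to its fibre component in e, so their smoothness comes from that of inversion
  -- at units.
  set Q : M → (Fib m →L[ℝ] Fib m) := fun x => ∑ a,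
    ContinuousLinearMap.smulRight (EuclideanSpace.proj a : Fib m →L[ℝ] ℝ)
      ((e (⟨x, s a x⟩ : TotalSpace (Fib m) E)).2) with hQ
  have hQs : ContMDiffAt (𝓡 n) 𝓘(ℝ, Fib m →L[ℝ] Fib m) ∞ Q w.proj := by
    refine ContMDiffAt.sum fun a _ => ?_
    have h1 : ContMDiffAt (𝓡 n) 𝓘(ℝ, Fib m) ∞
        (fun x => (e (⟨x, s a x⟩ : TotalSpace (Fib m) E)).2) w.proj :=
      (e.contMDiffAt_section_iff (IB := 𝓡 n) hwe).1 (hs.contMDiffAt hU hw a)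
    exact ((ContinuousLinearMap.smulRightL ℝ (Fib m) (Fib m)
      (EuclideanSpace.proj a)).contDiff.contMDiff.contMDiffAt).comp w.proj h1
  have hQapp : ∀ x ∈ U ∩ e.baseSet, ∀ c : Fib m,
      Q x c = (e (⟨x, ∑ a, c a • s a x⟩ : TotalSpace (Fib m) E)).2 := by
    intro x hx c
    have hlin : ∀ v : E x, (e (⟨x, v⟩ : TotalSpace (Fib m) E)).2 = e.linearEquivAt ℝ x hx.2 v :=
      fun v => rfl
    rw [hlin, map_sum]
    simp only [hQ, _root_.sum_apply, map_smul, hlin]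
    rfl
  -- Uniqueness of the coefficients in the frame makes Q x injective, hence invertible in finite
  -- dimension.
  have hQbij : ∀ x ∈ U ∩ e.baseSet, ∃ u : (Fib m →L[ℝ] Fib m)ˣ, (u : Fib m →L[ℝ] Fib m) = Q x := by
    intro x hx
    have hinj : Function.Injective (Q x) := by
      rw [injective_iff_map_eq_zero]
      intro c hc
      rw [hQapp x hx] at hc
      have hc' : e.linearEquivAt ℝ x hx.2 (∑ a, c a • s a x) = 0 := hc
      rw [LinearEquiv.map_eq_zero_iff] at hc'
      ext a
      have := coeff_sum_smul hs hx.1 (fun a => c a) a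
      rw [hc', map_zero] at this
      exact this.symm
    exact ⟨(ContinuousLinearEquiv.unitsEquiv ℝ (Fib m)).symm
      (LinearEquiv.ofInjectiveEndo (Q x).toLinearMap hinj).toContinuousLinearEquiv, by ext1; rfl⟩
  have hinv : ContMDiffAt (totModel n m) 𝓘(ℝ, Fib m →L[ℝ] Fib m) ∞
      (fun p : TotalSpace (Fib m) E => Ring.inverse (Q p.proj)) w := by
    obtain ⟨u, hu⟩ := hQbij w.proj ⟨hw, hwe⟩
    have h1 : ContMDiffAt 𝓘(ℝ, Fib m →L[ℝ] Fib m) 𝓘(ℝ, Fib m →L[ℝ] Fib m) ∞ Ring.inverse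
        (Q w.proj) := by
      rw [← hu]
      exact (contDiffAt_ringInverse ℝ u).contMDiffAt
    exact h1.comp w (hQs.comp w (contMDiff_proj E w))
  have hmain : ContMDiffAt (totModel n m) 𝓘(ℝ, ℝ) ∞
      (fun p => (EuclideanSpace.proj α : Fib m →L[ℝ] ℝ)
        (Ring.inverse (Q p.proj) (e p).2)) w :=
    ((EuclideanSpace.proj α : Fib m →L[ℝ] ℝ).contDiff.contMDiff.contMDiffAt).comp w
      (hinv.clm_apply hvec)
  refine hmain.congr_of_eventuallyEq ?_
  filter_upwards [(isOpen_proj_preimage (hU.inter e.open_baseSet)).mem_nhds ⟨hw, hwe⟩] with p hp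
  obtain ⟨u, hu⟩ := hQbij p.proj hp
  have h2 : Q p.proj (WithLp.toLp 2 fun a => hs.coeff a p.proj p.2) = (e p).2 := by
    rw [hQapp _ hp]
    change (e (⟨p.proj, ∑ a, hs.coeff a p.proj p.2 • s a p.proj⟩ : TotalSpace (Fib m) E)).2 = _
    rw [sum_coeff_smul hs hp.1]
  rw [← h2, ← hu, Ring.inverse_unit]
  have h3 : (↑u⁻¹ : Fib m →L[ℝ] Fib m) ((u : Fib m →L[ℝ] Fib m)
      (WithLp.toLp 2 fun a => hs.coeff a p.proj p.2))
      = WithLp.toLp 2 fun a => hs.coeff a p.proj p.2 := by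
    rw [← mul_apply_eq_comp, Units.inv_mul]
    rfl
  rw [h3]
  rfl

/-- A map into `E` over the identity of the base `E` is smooth if and only if its coefficients in
a local frame are. -/
lemma contMDiffAt_mk_iff {s : Fin m → ∀ x : M, E x} {U : Set M} (hU : IsOpen U)
    (hs : IsLocalFrameOn (𝓡 n) (Fib m) ∞ s U) {u : ∀ w : TotalSpace (Fib m) E, E w.proj}
    {w : TotalSpace (Fib m) E} (hw : w.proj ∈ U) :
    ContMDiffAt (totModel n m) (totModel n m) ∞
        (fun p => (⟨p.proj, u p⟩ : TotalSpace (Fib m) E)) w ↔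
      ∀ i, ContMDiffAt (totModel n m) 𝓘(ℝ, ℝ) ∞ (fun p => hs.coeff i p.proj (u p)) w := by
  constructor
  · intro h i
    have := (contMDiffOn_yCoord hU hs i).contMDiffAt
      (x := (⟨w.proj, u w⟩ : TotalSpace (Fib m) E)) ((isOpen_proj_preimage hU).mem_nhds hw)
    exact this.comp w h
  · intro h
    set e := trivializationAt (Fib m) E w.proj with he
    have hwe : w.proj ∈ e.baseSet := FiberBundle.mem_baseSet_trivializationAt' w.proj
    rw [e.contMDiffAt_iff (e.mem_source.2 hwe)]
    refine ⟨contMDiff_proj E w, ?_⟩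
    have h1 : ∀ a, ContMDiffAt (𝓡 n) 𝓘(ℝ, Fib m) ∞
        (fun x => (e (⟨x, s a x⟩ : TotalSpace (Fib m) E)).2) w.proj := fun a =>
      (e.contMDiffAt_section_iff (IB := 𝓡 n) hwe).1 (hs.contMDiffAt hU hw a)
    have h2 : ContMDiffAt (totModel n m) 𝓘(ℝ, Fib m) ∞
        (fun p => ∑ a, hs.coeff a p.proj (u p) •
          (e (⟨p.proj, s a p.proj⟩ : TotalSpace (Fib m) E)).2) w :=
      ContMDiffAt.sum fun a _ => (h a).smul ((h1 a).comp w (contMDiff_proj E w))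
    refine h2.congr_of_eventuallyEq ?_
    filter_upwards [(isOpen_proj_preimage (hU.inter e.open_baseSet)).mem_nhds ⟨hw, hwe⟩] with p hp
    have hlin : ∀ v : E p.proj,
        (e (⟨p.proj, v⟩ : TotalSpace (Fib m) E)).2 = e.linearEquivAt ℝ p.proj hp.2 v :=
      fun v => rfl
    conv_lhs => rw [← sum_coeff_smul hs hp.1 (u p)]
    rw [hlin, map_sum]
    simp only [map_smul, hlin]

/-! ### Tangent vectors of the total space -/

lemma mem_baseSet_of_mem_chart_source {w p : TotalSpace (Fib m) E}
    (hp : p ∈ (chartAt (ModelProd (EuclideanSpace ℝ (Fin n)) (Fib m)) w).source) :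
    p.proj ∈ (trivializationAt (Fib m) E w.proj).baseSet := by
  rw [FiberBundle.chartedSpace_chartAt] at hp
  simp only [mfld_simps] at hp
  exact (Trivialization.mem_source _).1 hp.1

/-- The chart of E at w is the preferred trivialization at π(w) followed by the chart of M on the
base factor. This splitting allows tangent vectors of E to be tested by Tπ and the functions
`frameCoeff` alone. -/
lemma extChartAt_apply_eq {w p : TotalSpace (Fib m) E}
    (hp : p ∈ (chartAt (ModelProd (EuclideanSpace ℝ (Fin n)) (Fib m)) w).source) :
    extChartAt (totModel n m) w p
      = (extChartAt (𝓡 n) w.proj p.proj, (trivializationAt (Fib m) E w.proj p).2) := by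
  rw [FiberBundle.extChartAt]
  have h := mem_baseSet_of_mem_chart_source hp
  change (extChartAt (𝓡 n) w.proj (trivializationAt (Fib m) E w.proj p).1, _) = _
  rw [Trivialization.coe_fst' _ h]
  rfl

lemma proj_mem_chart_source {w p : TotalSpace (Fib m) E}
    (hp : p ∈ (chartAt (ModelProd (EuclideanSpace ℝ (Fin n)) (Fib m)) w).source) :
    p.proj ∈ (chartAt (EuclideanSpace ℝ (Fin n)) w.proj).source := by
  have h := mem_baseSet_of_mem_chart_source hp
  rw [FiberBundle.chartedSpace_chartAt] at hp
  simp only [mfld_simps] at hp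
  have h2 := hp.2
  rwa [Trivialization.coe_fst' _ h] at h2

lemma mvfderiv_extChartAt_fst {w p : TotalSpace (Fib m) E}
    (hp : p ∈ (chartAt (ModelProd (EuclideanSpace ℝ (Fin n)) (Fib m)) w).source)
    (ξ : TangentSpace (totModel n m) p) :
    (mvfderiv (totModel n m) (extChartAt (totModel n m) w) p ξ).1
      = mvfderiv (𝓡 n) (extChartAt (𝓡 n) w.proj) p.proj
        (mfderiv (totModel n m) (𝓡 n) (TotalSpace.proj : TotalSpace (Fib m) E → M) p ξ) := by
  have hd : MDifferentiableAt (totModel n m) 𝓘(ℝ, EuclideanSpace ℝ (Fin n) × Fib m)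
      (extChartAt (totModel n m) w) p := mdifferentiableAt_extChartAt hp
  have hd' : MDifferentiableAt (𝓡 n) 𝓘(ℝ, EuclideanSpace ℝ (Fin n))
      (extChartAt (𝓡 n) w.proj) p.proj := mdifferentiableAt_extChartAt (proj_mem_chart_source hp)
  refine Eq.trans ?_ (mfderiv_comp_apply p hd' (mdifferentiableAt_proj p) ξ)
  set L := ContinuousLinearMap.fst ℝ (EuclideanSpace ℝ (Fin n)) (Fib m)
  have hL : MDifferentiableAt 𝓘(ℝ, EuclideanSpace ℝ (Fin n) × Fib m)
      𝓘(ℝ, EuclideanSpace ℝ (Fin n)) L (extChartAt (totModel n m) w p) :=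
    L.differentiableAt.mdifferentiableAt
  have h1 := mfderiv_comp_apply p hL hd ξ
  have h2 : mfderiv 𝓘(ℝ, EuclideanSpace ℝ (Fin n) × Fib m) 𝓘(ℝ, EuclideanSpace ℝ (Fin n)) L
      (extChartAt (totModel n m) w p)
      = L := by
    rw [mfderiv_eq_fderiv]
    erw [ContinuousLinearMap.fderiv]
  rw [h2] at h1
  refine h1.symm.trans ?_
  refine congrArg (fun K : TangentSpace (totModel n m) p →L[ℝ] _ => K ξ)
    (Filter.EventuallyEq.mfderiv_eq ?_)
  filter_upwards [(chartAt _ w).open_source.mem_nhds hp] with q hq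
  change (extChartAt (totModel n m) w q).1 = _
  rw [extChartAt_apply_eq hq]
  rfl

lemma mvfderiv_extChartAt_snd {w p : TotalSpace (Fib m) E}
    (hp : p ∈ (chartAt (ModelProd (EuclideanSpace ℝ (Fin n)) (Fib m)) w).source)
    (ξ : TangentSpace (totModel n m) p) (i : Fin m) :
    (mvfderiv (totModel n m) (extChartAt (totModel n m) w) p ξ).2 i
      = mvfderiv (totModel n m) (frameCoeff m E w.proj i) p ξ := by
  have hd : MDifferentiableAt (totModel n m) 𝓘(ℝ, EuclideanSpace ℝ (Fin n) × Fib m)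
      (extChartAt (totModel n m) w) p := mdifferentiableAt_extChartAt hp
  set L := (EuclideanSpace.proj i : Fib m →L[ℝ] ℝ) ∘L
    ContinuousLinearMap.snd ℝ (EuclideanSpace ℝ (Fin n)) (Fib m)
  have hL : MDifferentiableAt 𝓘(ℝ, EuclideanSpace ℝ (Fin n) × Fib m)
      𝓘(ℝ, ℝ) L (extChartAt (totModel n m) w p) :=
    L.differentiableAt.mdifferentiableAt
  have h1 := mvfderiv_comp_apply p hL hd ξ
  have h2 : mvfderiv 𝓘(ℝ, EuclideanSpace ℝ (Fin n) × Fib m) L (extChartAt (totModel n m) w p)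
      = L := by
    rw [mvfderiv, mfderiv_eq_fderiv]
    erw [ContinuousLinearMap.fderiv]
    rfl
  rw [h2] at h1
  refine h1.symm.trans ?_
  refine congrArg (fun K : TangentSpace (totModel n m) p →L[ℝ] _ => K ξ)
    (Filter.EventuallyEq.mfderiv_eq ?_)
  filter_upwards [(chartAt _ w).open_source.mem_nhds hp] with q hq
  change (extChartAt (totModel n m) w q).2 i = _
  rw [extChartAt_apply_eq hq]
  rfl

/-- A tangent vector of the total space is determined by its projection to the base and its
action on the fibre coordinates. -/
lemma ext_tangent {w : TotalSpace (Fib m) E} {ξ η : TangentSpace (totModel n m) w}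
    (h1 : mfderiv (totModel n m) (𝓡 n) (TotalSpace.proj : TotalSpace (Fib m) E → M) w ξ
      = mfderiv (totModel n m) (𝓡 n) (TotalSpace.proj : TotalSpace (Fib m) E → M) w η)
    (h2 : ∀ i, mvfderiv (totModel n m) (frameCoeff m E w.proj i) w ξ
      = mvfderiv (totModel n m) (frameCoeff m E w.proj i) w η) : ξ = η := by
  have hp := mem_chart_source (ModelProd (EuclideanSpace ℝ (Fin n)) (Fib m)) w
  have hinv := isInvertible_mfderiv_extChartAt (I := totModel n m)
    (mem_extChartAt_source (I := totModel n m) w)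
  apply hinv.injective
  have h : mvfderiv (totModel n m) (extChartAt (totModel n m) w) w ξ
      = mvfderiv (totModel n m) (extChartAt (totModel n m) w) w η := by
    refine Prod.ext ?_ (PiLp.ext fun i => ?_)
    · rw [mvfderiv_extChartAt_fst hp, mvfderiv_extChartAt_fst hp, h1]
    · rw [mvfderiv_extChartAt_snd hp, mvfderiv_extChartAt_snd hp, h2]
  exact h

/-- A vector field on the total space is smooth if its expression in a chart is. -/
lemma contMDiffAt_vectorField {w : TotalSpace (Fib m) E}
    {W : ∀ p : TotalSpace (Fib m) E, TangentSpace (totModel n m) p}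
    (h : ContMDiffAt (totModel n m) 𝓘(ℝ, EuclideanSpace ℝ (Fin n) × Fib m) ∞
      (fun p => mvfderiv (totModel n m) (extChartAt (totModel n m) w) p (W p)) w) :
    ContMDiffAt (totModel n m) (totModel n m).tangent ∞
      (fun p => (⟨p, W p⟩ : TangentBundle (totModel n m) (TotalSpace (Fib m) E))) w := by
  rw [contMDiffAt_section]
  refine h.congr_of_eventuallyEq ?_
  filter_upwards [(chartAt (ModelProd (EuclideanSpace ℝ (Fin n)) (Fib m)) w).open_source.mem_nhds
    (mem_chart_source _ w)] with p hp
  have h1 := TangentBundle.continuousLinearMapAt_trivializationAt (𝕜 := ℝ) (I := totModel n m) hp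
  have h2 := congrArg (fun K : TangentSpace (totModel n m) p →L[ℝ] _ => K (W p)) h1
  refine Eq.trans ?_ h2
  symm
  refine Trivialization.continuousLinearMapAt_apply_of_mem (R := ℝ) _ ?_ _
  rw [TangentBundle.trivializationAt_baseSet]
  exact hp

lemma mvfderiv_vlift {w : TotalSpace (Fib m) E} (a : E w.proj) {f : TotalSpace (Fib m) E → ℝ}
    (hf : MDifferentiableAt (totModel n m) 𝓘(ℝ, ℝ) f w) :
    mvfderiv (totModel n m) f w (vlift w a)
      = deriv (fun t : ℝ => f ⟨w.proj, w.2 + t • a⟩) 0 := by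
  have hc : MDifferentiableAt 𝓘(ℝ, ℝ) (totModel n m)
      (fun t : ℝ => (⟨w.proj, w.2 + t • a⟩ : TotalSpace (Fib m) E)) 0 :=
    (contMDiff_fibre_line w.proj w.2 a 0).mdifferentiableAt (by simp)
  have h0 : (⟨w.proj, w.2 + (0 : ℝ) • a⟩ : TotalSpace (Fib m) E) = w := by simp
  have h := mvfderiv_comp_apply_of_eq (0 : ℝ) hf hc h0 (1 : ℝ)
  refine h.symm.trans ?_
  rw [mvfderiv, mfderiv_eq_fderiv]
  rfl

lemma mvfderiv_yCoord_vlift {s : Fin m → ∀ x : M, E x} {U : Set M} (hU : IsOpen U)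
    (hs : IsLocalFrameOn (𝓡 n) (Fib m) ∞ s U) (α : Fin m) {w : TotalSpace (Fib m) E}
    (hw : w.proj ∈ U) (a : E w.proj) :
    mvfderiv (totModel n m) (yCoord hs α) w (vlift w a) = hs.coeff α w.proj a := by
  rw [mvfderiv_vlift a (((contMDiffOn_yCoord hU hs α).contMDiffAt
    ((isOpen_proj_preimage hU).mem_nhds hw)).mdifferentiableAt (by simp))]
  have : (fun t : ℝ => yCoord hs α (⟨w.proj, w.2 + t • a⟩ : TotalSpace (Fib m) E))
      = fun t => hs.coeff α w.proj w.2 + t * hs.coeff α w.proj a := by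
    funext t
    simp [yCoord]
  rw [this]
  simp

lemma frameCoeff_eventuallyEq {x : M} {w : TotalSpace (Fib m) E}
    (hw : w.proj ∈ (trivializationAt (Fib m) E x).baseSet) (i : Fin m) :
    frameCoeff m E x i =ᶠ[𝓝 w] yCoord (isLocalFrameOn_frameAt (n := n) x) i := by
  filter_upwards [(isOpen_proj_preimage (trivializationAt (Fib m) E x).open_baseSet).mem_nhds hw]
    with p hp
  exact frameCoeff_eq_coeff hp i

lemma mvfderiv_frameCoeff_vlift {x : M} {w : TotalSpace (Fib m) E}
    (hw : w.proj ∈ (trivializationAt (Fib m) E x).baseSet) (i : Fin m) (a : E w.proj) :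
    mvfderiv (totModel n m) (frameCoeff m E x i) w (vlift w a)
      = frameCoeff m E x i ⟨w.proj, a⟩ := by
  rw [frameCoeff_eq_coeff (n := n) (p := ⟨w.proj, a⟩) hw,
    ← mvfderiv_yCoord_vlift (trivializationAt (Fib m) E x).open_baseSet _ i hw a]
  exact congrArg (fun K : TangentSpace (totModel n m) w →L[ℝ] _ => K (vlift w a))
    (frameCoeff_eventuallyEq hw i).mfderiv_eq

/-- The vertical lift of a smooth map into `E` over the identity is a smooth vector field. -/
lemma contMDiffAt_vlift {u : ∀ w : TotalSpace (Fib m) E, E w.proj} {w : TotalSpace (Fib m) E}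
    (hu : ContMDiffAt (totModel n m) (totModel n m) ∞
      (fun p => (⟨p.proj, u p⟩ : TotalSpace (Fib m) E)) w) :
    ContMDiffAt (totModel n m) (totModel n m).tangent ∞
      (fun p => (⟨p, vlift p (u p)⟩ : TangentBundle (totModel n m) (TotalSpace (Fib m) E))) w := by
  apply contMDiffAt_vectorField
  set e := trivializationAt (Fib m) E w.proj with he
  have hwe : w.proj ∈ e.baseSet := FiberBundle.mem_baseSet_trivializationAt' w.proj
  have h := ((e.contMDiffAt_iff (e.mem_source.2 hwe)).1 hu).2
  set L := ContinuousLinearMap.inr ℝ (EuclideanSpace ℝ (Fin n)) (Fib m)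
  refine (L.contDiff.contMDiff.contMDiffAt.comp w h).congr_of_eventuallyEq ?_
  filter_upwards [(chartAt (ModelProd (EuclideanSpace ℝ (Fin n)) (Fib m)) w).open_source.mem_nhds
    (mem_chart_source _ w)] with p hp
  refine Prod.ext ?_ (PiLp.ext fun i => ?_)
  · rw [mvfderiv_extChartAt_fst hp, mfderiv_proj_vlift, map_zero]
    rfl
  · rw [mvfderiv_extChartAt_snd hp, mvfderiv_frameCoeff_vlift (mem_baseSet_of_mem_chart_source hp)]
    rfl

/-- Both sides are killed by Tπ and have the same fibre coordinates, so `ext_tangent` identifies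
them. Thus ker Tπ consists of vertical lifts. -/
lemma vlift_coeff {w : TotalSpace (Fib m) E} {ξ : TangentSpace (totModel n m) w}
    (hξ : mfderiv (totModel n m) (𝓡 n) (TotalSpace.proj : TotalSpace (Fib m) E → M) w ξ = 0) :
    vlift w (∑ i, mvfderiv (totModel n m) (frameCoeff m E w.proj i) w ξ •
      frameAt m E w.proj i w.proj) = ξ := by
  have hwe : w.proj ∈ (trivializationAt (Fib m) E w.proj).baseSet :=
    FiberBundle.mem_baseSet_trivializationAt' w.proj
  refine ext_tangent ?_ fun i => ?_
  · rw [mfderiv_proj_vlift, hξ]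
  · rw [mvfderiv_frameCoeff_vlift hwe, frameCoeff_eq_coeff (n := n)
      (p := (⟨w.proj, ∑ i, _ • frameAt m E w.proj i w.proj⟩ : TotalSpace (Fib m) E)) hwe]
    exact coeff_sum_smul _ hwe _ i

/-- `vlift` is the velocity of a curve, so linearity in the vector is not definitional. It is read
off from the fibre coordinates of the lift, which are the coefficients of the vector. -/
lemma vlift_add (w : TotalSpace (Fib m) E) (a b : E w.proj) :
    vlift (n := n) w (a + b) = vlift w a + vlift w b := by
  have hwe : w.proj ∈ (trivializationAt (Fib m) E w.proj).baseSet :=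
    FiberBundle.mem_baseSet_trivializationAt' w.proj
  refine ext_tangent ?_ fun i => ?_
  · simp only [map_add, mfderiv_proj_vlift, add_zero]
  · simp only [map_add, mvfderiv_frameCoeff_vlift hwe,
      fun c => frameCoeff_eq_coeff (n := n) (p := ⟨w.proj, c⟩) hwe]

lemma vlift_smul (w : TotalSpace (Fib m) E) (c : ℝ) (a : E w.proj) :
    vlift (n := n) w (c • a) = c • vlift w a := by
  have hwe : w.proj ∈ (trivializationAt (Fib m) E w.proj).baseSet :=
    FiberBundle.mem_baseSet_trivializationAt' w.proj
  refine ext_tangent ?_ fun i => ?_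
  · simp only [map_smul, mfderiv_proj_vlift, smul_zero]
  · simp only [map_smul, mvfderiv_frameCoeff_vlift hwe,
      fun c => frameCoeff_eq_coeff (n := n) (p := ⟨w.proj, c⟩) hwe]

lemma vlift_injective (w : TotalSpace (Fib m) E) :
    Function.Injective (vlift (n := n) w) := by
  intro a b hab
  have hwe : w.proj ∈ (trivializationAt (Fib m) E w.proj).baseSet :=
    FiberBundle.mem_baseSet_trivializationAt' w.proj
  refine ext_coeff (isLocalFrameOn_frameAt (n := n) w.proj) hwe fun i => ?_
  rw [← mvfderiv_yCoord_vlift (trivializationAt (Fib m) E w.proj).open_baseSet _ i hwe a, hab,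
    mvfderiv_yCoord_vlift (trivializationAt (Fib m) E w.proj).open_baseSet _ i hwe b]

/-! ### The bracket of local sections of `E` -/

lemma mvfderiv_congr {V H P : Type*} [NormedAddCommGroup V] [NormedSpace ℝ V]
    [TopologicalSpace H] {I : ModelWithCorners ℝ V H} [TopologicalSpace P] [ChartedSpace H P]
    {f g : P → ℝ} {x : P} (h : f =ᶠ[𝓝 x] g) (ξ : TangentSpace I x) :
    mvfderiv I f x ξ = mvfderiv I g x ξ :=
  congrArg (fun L : TangentSpace I x →L[ℝ] ℝ => L ξ) h.mfderiv_eq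

lemma exists_global_function [T2Space M] {f : M → ℝ} {U : Set M} {x : M} (hU : IsOpen U)
    (hx : x ∈ U) (hf : ContMDiffOn (𝓡 n) 𝓘(ℝ, ℝ) ∞ f U) :
    ∃ F : M → ℝ, ContMDiff (𝓡 n) 𝓘(ℝ, ℝ) ∞ F ∧ F =ᶠ[𝓝 x] f := by
  obtain ⟨b, -, hb⟩ := (SmoothBumpFunction.nhds_basis_tsupport (I := 𝓡 n) x).mem_iff.1
    (hU.mem_nhds hx)
  refine ⟨fun y => b y * f y, ?_, ?_⟩
  · refine contMDiff_of_tsupport fun y hy => ?_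
    have : y ∈ tsupport b := closure_mono (Function.support_mul_subset_left _ _) hy
    exact (b.contMDiff y).mul (hf.contMDiffAt (hU.mem_nhds (hb this)))
  · filter_upwards [b.eventuallyEq_one] with y hy
    rw [hy, Pi.one_apply, one_mul]

/-- The product of a smooth section of `E` by a smooth function on `M`. -/
def smulSection (f : M → ℝ) (hf : ContMDiff (𝓡 n) 𝓘(ℝ, ℝ) ∞ f) (σ : Cₛ^∞⟮𝓡 n; Fib m, E⟯) :
    Cₛ^∞⟮𝓡 n; Fib m, E⟯ :=
  ⟨fun x => f x • σ x, hf.smul_section σ.contMDiff⟩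

lemma sum_section_apply {ι : Type*} (t : Finset ι) (σ : ι → Cₛ^∞⟮𝓡 n; Fib m, E⟯) (x : M) :
    (∑ i ∈ t, σ i) x = ∑ i ∈ t, σ i x := by
  have := map_sum (ContMDiffSection.coeAddHom (𝓡 n) (Fib m) ∞ E) σ t
  have h := congrFun this x
  rw [Finset.sum_apply] at h
  exact h

lemma bracket_skew (A : LieAlgebroid n m E) (σ τ : Cₛ^∞⟮𝓡 n; Fib m, E⟯) :
    A.bracket σ τ = -A.bracket τ σ := by
  have h := A.bracket_self (σ + τ)
  simp only [map_add, LinearMap.add_apply, A.bracket_self, zero_add, add_zero] at h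
  exact eq_neg_of_add_eq_zero_right h

/-- The bracket is a local operator. -/
lemma bracket_congr_right [T2Space M] (A : LieAlgebroid n m E) (σ : Cₛ^∞⟮𝓡 n; Fib m, E⟯)
    {τ τ' : Cₛ^∞⟮𝓡 n; Fib m, E⟯} {x : M} (h : ∀ᶠ y in 𝓝 x, τ y = τ' y) :
    A.bracket σ τ x = A.bracket σ τ' x := by
  rw [← sub_eq_zero]
  set d := τ - τ' with hd
  have hd0 : ∀ᶠ y in 𝓝 x, d y = 0 := h.mono fun y hy => sub_eq_zero.2 hy
  have e1 : A.bracket σ τ x - A.bracket σ τ' x = A.bracket σ d x := by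
    rw [hd, map_sub]
    rfl
  rw [e1]
  obtain ⟨b, -, hb⟩ := (SmoothBumpFunction.nhds_basis_tsupport (I := 𝓡 n) x).mem_iff.1 hd0
  -- The bump function is supported where d vanishes, so b • d = 0 globally, while b x = 1. The
  -- Leibniz rule then reads 0 = [σ, d](x) + σ(b)(x) d(x), and d x = 0.
  have hz : ∀ y, (0 : Cₛ^∞⟮𝓡 n; Fib m, E⟯) y = b y • d y := by
    intro y
    by_cases hy : b y = 0
    · rw [hy, zero_smul]
      rfl
    · have h2 : d y = 0 := hb (subset_tsupport _ hy)
      rw [h2, smul_zero]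
      rfl
  have h3 := A.leibniz σ d 0 b b.contMDiff hz x
  have h4 : d x = 0 := hd0.self_of_nhds
  rw [map_zero, h4, smul_zero, add_zero, b.eq_one, one_smul] at h3
  exact h3.symm

lemma bracket_congr [T2Space M] (A : LieAlgebroid n m E)
    {σ σ' τ τ' : Cₛ^∞⟮𝓡 n; Fib m, E⟯} {x : M} (h : ∀ᶠ y in 𝓝 x, σ y = σ' y)
    (h' : ∀ᶠ y in 𝓝 x, τ y = τ' y) :
    A.bracket σ τ x = A.bracket σ' τ' x := by
  rw [A.bracket_congr_right σ h', A.bracket_skew σ, A.bracket_skew σ']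
  exact congrArg Neg.neg (A.bracket_congr_right τ' h)

/-- Locality of the bracket makes the extensions chosen in `localBracket` immaterial, so any
convenient pair may replace them. -/
lemma localBracket_eq [T2Space M] (A : LieAlgebroid n m E) {s t : ∀ y : M, E y} {x : M}
    {σ τ : Cₛ^∞⟮𝓡 n; Fib m, E⟯} (hσ : ∀ᶠ y in 𝓝 x, σ y = s y) (hτ : ∀ᶠ y in 𝓝 x, τ y = t y) :
    A.localBracket s t x = A.bracket σ τ x := by
  have h : ∃ p : Cₛ^∞⟮𝓡 n; Fib m, E⟯ × Cₛ^∞⟮𝓡 n; Fib m, E⟯,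
      (∀ᶠ y in 𝓝 x, p.1 y = s y) ∧ (∀ᶠ y in 𝓝 x, p.2 y = t y) := ⟨(σ, τ), hσ, hτ⟩
  rw [localBracket, dif_pos h]
  refine A.bracket_congr ?_ ?_
  · filter_upwards [h.choose_spec.1, hσ] with y h1 h2
    rw [h1, h2]
  · filter_upwards [h.choose_spec.2, hτ] with y h1 h2
    rw [h1, h2]

lemma contMDiffAt_localBracket [T2Space M] (A : LieAlgebroid n m E) {s t : ∀ y : M, E y}
    {U : Set M} {x : M} (hU : IsOpen U) (hx : x ∈ U)
    (hs : ContMDiffOn (𝓡 n) (totModel n m) ∞ (fun y => (⟨y, s y⟩ : TotalSpace (Fib m) E)) U)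
    (ht : ContMDiffOn (𝓡 n) (totModel n m) ∞ (fun y => (⟨y, t y⟩ : TotalSpace (Fib m) E)) U) :
    ContMDiffAt (𝓡 n) (totModel n m) ∞
      (fun y => (⟨y, A.localBracket s t y⟩ : TotalSpace (Fib m) E)) x := by
  obtain ⟨σ, hσ⟩ := exists_global_extension (n := n) hU hx hs
  obtain ⟨τ, hτ⟩ := exists_global_extension (n := n) hU hx ht
  refine ((A.bracket σ τ).contMDiff x).congr_of_eventuallyEq ?_
  filter_upwards [hσ.eventually_nhds, hτ.eventually_nhds] with y h1 h2
  rw [A.localBracket_eq h1 h2]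

lemma bracket_sum_smul_right [T2Space M] (A : LieAlgebroid n m E) {ι : Type*} [Fintype ι]
    (σ τ : Cₛ^∞⟮𝓡 n; Fib m, E⟯) (ε : ι → Cₛ^∞⟮𝓡 n; Fib m, E⟯) {G : ι → M → ℝ}
    (hG : ∀ a, ContMDiff (𝓡 n) 𝓘(ℝ, ℝ) ∞ (G a)) {x : M}
    (hτ : ∀ᶠ y in 𝓝 x, τ y = ∑ a, G a y • ε a y) :
    A.bracket σ τ x = ∑ a, (G a x • A.bracket σ (ε a) x
      + mvfderiv (𝓡 n) (G a) x (A.anchor x (σ x)) • ε a x) := by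
  have h1 : ∀ᶠ y in 𝓝 x, τ y = (∑ a, smulSection (G a) (hG a) (ε a)) y := by
    filter_upwards [hτ] with y hy
    rw [sum_section_apply, hy]
    rfl
  rw [A.bracket_congr_right σ h1, map_sum, sum_section_apply]
  exact Finset.sum_congr rfl fun a _ => A.leibniz σ (ε a) _ (G a) (hG a) (fun _ => rfl) x

lemma contMDiffOn_coeff {s : Fin m → ∀ x : M, E x} {U V : Set M} (hU : IsOpen U)
    (hs : IsLocalFrameOn (𝓡 n) (Fib m) ∞ s U) {t : ∀ x : M, E x}
    (ht : ContMDiffOn (𝓡 n) (totModel n m) ∞ (fun y => (⟨y, t y⟩ : TotalSpace (Fib m) E)) V)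
    (a : Fin m) :
    ContMDiffOn (𝓡 n) 𝓘(ℝ, ℝ) ∞ (fun y => hs.coeff a y (t y)) (U ∩ V) :=
  (contMDiffOn_yCoord hU hs a).comp (ht.mono inter_subset_right) fun _ hy => hy.1

/-- The bracket of two local sections in terms of their coefficients in a local frame. -/
lemma localBracket_frame [T2Space M] (A : LieAlgebroid n m E) {s t : ∀ y : M, E y} {V : Set M}
    {x : M} (hV : IsOpen V) (hxV : x ∈ V)
    (hs : ContMDiffOn (𝓡 n) (totModel n m) ∞ (fun y => (⟨y, s y⟩ : TotalSpace (Fib m) E)) V)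
    (ht : ContMDiffOn (𝓡 n) (totModel n m) ∞ (fun y => (⟨y, t y⟩ : TotalSpace (Fib m) E)) V)
    {e : Fin m → ∀ x : M, E x} {U : Set M} (hU : IsOpen U) (hxU : x ∈ U)
    (he : IsLocalFrameOn (𝓡 n) (Fib m) ∞ e U) :
    A.localBracket s t x
      = ∑ a, (mvfderiv (𝓡 n) (fun y => he.coeff a y (t y)) x (A.anchor x (s x))
          - mvfderiv (𝓡 n) (fun y => he.coeff a y (s y)) x (A.anchor x (t x))) • e a x
        + ∑ a, ∑ b, (he.coeff a x (s x) * he.coeff b x (t x)) •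
          A.localBracket (e a) (e b) x := by
  obtain ⟨σ, hσ⟩ := exists_global_extension (n := n) hV hxV hs
  obtain ⟨τ, hτ⟩ := exists_global_extension (n := n) hV hxV ht
  choose ε hε using fun a => exists_global_extension (n := n) hU hxU (he.contMDiffOn a)
  choose F hF hFe using fun a => exists_global_function (hU.inter hV) ⟨hxU, hxV⟩
    (contMDiffOn_coeff hU he hs a)
  choose G hG hGe using fun a => exists_global_function (hU.inter hV) ⟨hxU, hxV⟩
    (contMDiffOn_coeff hU he ht a)
  have hσF : ∀ᶠ y in 𝓝 x, σ y = ∑ a, F a y • ε a y := by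
    filter_upwards [hσ, hU.mem_nhds hxU, eventually_all.2 hε, eventually_all.2 hFe] with y h1 h2 h3 h4
    rw [h1, ← sum_coeff_smul he h2 (s y)]
    exact Finset.sum_congr rfl fun a _ => by rw [h3, h4]
  have hτG : ∀ᶠ y in 𝓝 x, τ y = ∑ a, G a y • ε a y := by
    filter_upwards [hτ, hU.mem_nhds hxU, eventually_all.2 hε, eventually_all.2 hGe] with y h1 h2 h3 h4
    rw [h1, ← sum_coeff_smul he h2 (t y)]
    exact Finset.sum_congr rfl fun a _ => by rw [h3, h4]
  rw [A.localBracket_eq hσ hτ, A.bracket_sum_smul_right σ τ ε hG hτG]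
  -- The Leibniz rule is an axiom in the second argument only; skew-symmetry carries it over to the
  -- first.
  have h1 : ∀ a, A.bracket σ (ε a) x = ∑ b, F b x • A.localBracket (e b) (e a) x
      - ∑ b, mvfderiv (𝓡 n) (F b) x (A.anchor x (e a x)) • e b x := by
    intro a
    rw [A.bracket_skew]
    have h2 := A.bracket_sum_smul_right (ε a) σ ε hF hσF
    refine (congrArg Neg.neg h2).trans ?_
    rw [Finset.sum_add_distrib, neg_add, sub_eq_add_neg, ← Finset.sum_neg_distrib,
      ← Finset.sum_neg_distrib, (hε a).self_of_nhds]
    congr 1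
    · refine Finset.sum_congr rfl fun b _ => ?_
      rw [A.localBracket_eq (hε b) (hε a), A.bracket_skew (ε b), ← smul_neg]
      rfl
    · rw [← Finset.sum_neg_distrib]
      exact Finset.sum_congr rfl fun b _ => by rw [(hε b).self_of_nhds]
  have hsx : A.anchor x (t x) = ∑ a, G a x • A.anchor x (e a x) := by
    rw [← hτ.self_of_nhds, hτG.self_of_nhds, map_sum]
    exact Finset.sum_congr rfl fun a _ => by rw [map_smul, (hε a).self_of_nhds]
  have h3 : ∀ a, mvfderiv (𝓡 n) (fun y => he.coeff a y (s y)) x (A.anchor x (t x))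
      = ∑ b, G b x * mvfderiv (𝓡 n) (F a) x (A.anchor x (e b x)) := by
    intro a
    rw [← mvfderiv_congr (hFe a), hsx, map_sum]
    exact Finset.sum_congr rfl fun b _ => by rw [map_smul, smul_eq_mul]
  have h4 : ∀ a, mvfderiv (𝓡 n) (fun y => he.coeff a y (t y)) x (A.anchor x (s x))
      = mvfderiv (𝓡 n) (G a) x (A.anchor x (σ x)) := by
    intro a
    rw [← mvfderiv_congr (hGe a), hσ.self_of_nhds]
  have h5 : ∀ a, he.coeff a x (s x) = F a x := fun a => (hFe a).self_of_nhds.symm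
  have h6 : ∀ a, he.coeff a x (t x) = G a x := fun a => (hGe a).self_of_nhds.symm
  simp only [h1, h3, h4, h5, h6, fun a => (hε a).self_of_nhds]
  simp only [smul_sub, sub_smul, Finset.smul_sum, Finset.sum_smul, Finset.sum_add_distrib,
    Finset.sum_sub_distrib, smul_smul]
  rw [Finset.sum_comm (f := fun a b => (G a x * mvfderiv (𝓡 n) (F b) x (A.anchor x (e a x))) •
    e b x), Finset.sum_comm (f := fun a b => (G a x * F b x) • A.localBracket (e b) (e a) x)]
  simp only [mul_comm (F _ x) (G _ x)]
  abel

/-! ### Smooth sections of the prolongation and their bracket -/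

lemma mfderiv_proj_snd (A : LieAlgebroid n m E) {w : TotalSpace (Fib m) E} (p : A.Prol w) :
    mfderiv (totModel n m) (𝓡 n) (TotalSpace.proj : TotalSpace (Fib m) E → M) w p.1.2
      = A.anchor w.proj p.1.1 :=
  Eq.symm p.2

lemma isSmooth_iff (A : LieAlgebroid n m E) {X : A.Sec} :
    A.IsSmooth X ↔ ∀ w ∈ slit m E,
      ContMDiffAt (totModel n m) (totModel n m) ∞
        (fun p => (⟨p.proj, (X p).1.1⟩ : TotalSpace (Fib m) E)) w ∧
      ContMDiffAt (totModel n m) (totModel n m).tangent ∞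
        (fun w => (⟨w, (X w).1.2⟩ : TangentBundle (totModel n m) (TotalSpace (Fib m) E))) w :=
  ⟨fun h _ hw => ⟨h.1.contMDiffAt (slit_mem_nhds hw), h.2.contMDiffAt (slit_mem_nhds hw)⟩,
    fun h => ⟨fun w hw => (h w hw).1.contMDiffWithinAt, fun w hw => (h w hw).2.contMDiffWithinAt⟩⟩

lemma IsSmooth.congr {A : LieAlgebroid n m E} {X Y : A.Sec} (hX : A.IsSmooth X)
    (h : ∀ w ∈ slit m E, Y w = X w) : A.IsSmooth Y :=
  ⟨hX.1.congr fun w hw => by rw [h w hw], hX.2.congr fun w hw => by rw [h w hw]⟩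

lemma IsSmooth.contMDiffOn_coeff {A : LieAlgebroid n m E} {X : A.Sec} (hX : A.IsSmooth X)
    {s : Fin m → ∀ x : M, E x} {U : Set M} (hU : IsOpen U)
    (hs : IsLocalFrameOn (𝓡 n) (Fib m) ∞ s U) (i : Fin m) :
    ContMDiffOn (totModel n m) 𝓘(ℝ, ℝ) ∞ (fun p => hs.coeff i p.proj (X p).1.1)
      (slit m E ∩ TotalSpace.proj ⁻¹' U) := by
  intro p hp
  exact ((contMDiffAt_mk_iff hU hs hp.2).1 (A.isSmooth_iff.1 hX p hp.1).1 i).contMDiffWithinAt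

lemma isOpen_slit_inter {U : Set M} (hU : IsOpen U) :
    IsOpen (slit m E ∩ TotalSpace.proj ⁻¹' U) :=
  isOpen_slit.inter (isOpen_proj_preimage hU)

lemma IsSmooth.mdifferentiableAt_coeff {A : LieAlgebroid n m E} {X : A.Sec} (hX : A.IsSmooth X)
    {s : Fin m → ∀ x : M, E x} {U : Set M} (hU : IsOpen U)
    (hs : IsLocalFrameOn (𝓡 n) (Fib m) ∞ s U) (i : Fin m) {w : TotalSpace (Fib m) E}
    (hw : w ∈ slit m E) (hwU : w.proj ∈ U) :
    MDifferentiableAt (totModel n m) 𝓘(ℝ, ℝ) (fun p => hs.coeff i p.proj (X p).1.1) w :=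
  ((hX.contMDiffOn_coeff hU hs i).contMDiffAt
    ((isOpen_slit_inter hU).mem_nhds ⟨hw, hwU⟩)).mdifferentiableAt (by simp)

lemma IsSmooth.mdifferentiableAt_snd {A : LieAlgebroid n m E} {X : A.Sec} (hX : A.IsSmooth X)
    {w : TotalSpace (Fib m) E} (hw : w ∈ slit m E) :
    MDifferentiableAt (totModel n m) (totModel n m).tangent
      (fun w => (⟨w, (X w).1.2⟩ : TangentBundle (totModel n m) (TotalSpace (Fib m) E))) w :=
  (A.isSmooth_iff.1 hX w hw).2.mdifferentiableAt (by simp)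

lemma IsSmooth.contMDiffOn_along {A : LieAlgebroid n m E} {X : A.Sec} (hX : A.IsSmooth X)
    {f : TotalSpace (Fib m) E → ℝ} {O : Set (TotalSpace (Fib m) E)} (hO : IsOpen O)
    (hOs : O ⊆ slit m E) (hf : ContMDiffOn (totModel n m) 𝓘(ℝ, ℝ) ∞ f O) :
    ContMDiffOn (totModel n m) 𝓘(ℝ, ℝ) ∞ (A.along X f) O := fun w hw =>
  (contMDiffAt_mvfderiv_apply hO hw hf (A.isSmooth_iff.1 hX w (hOs hw)).2).contMDiffWithinAt

lemma isSmooth_of_coeff {A : LieAlgebroid n m E} {X : A.Sec}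
    (h1 : ∀ w ∈ slit m E, ∀ i, ContMDiffAt (totModel n m) 𝓘(ℝ, ℝ) ∞
      (fun p => (isLocalFrameOn_frameAt (n := n) (m := m) (E := E) w.proj).coeff i p.proj (X p).1.1) w)
    (h2 : ContMDiffOn (totModel n m) (totModel n m).tangent ∞
      (fun w => (⟨w, (X w).1.2⟩ : TangentBundle (totModel n m) (TotalSpace (Fib m) E)))
      (slit m E)) : A.IsSmooth X :=
  A.isSmooth_iff.2 fun w hw => ⟨(contMDiffAt_mk_iff (trivializationAt (Fib m) E w.proj).open_baseSet
    _ (FiberBundle.mem_baseSet_trivializationAt' w.proj)).2 (h1 w hw),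
    h2.contMDiffAt (slit_mem_nhds hw)⟩

lemma IsSmooth.contMDiffAt_frameAt_coeff {A : LieAlgebroid n m E} {X : A.Sec} (hX : A.IsSmooth X)
    {w : TotalSpace (Fib m) E} (hw : w ∈ slit m E) (i : Fin m) :
    ContMDiffAt (totModel n m) 𝓘(ℝ, ℝ) ∞
      (fun p => (isLocalFrameOn_frameAt (n := n) w.proj).coeff i p.proj (X p).1.1) w :=
  (hX.contMDiffOn_coeff (trivializationAt (Fib m) E w.proj).open_baseSet _ i).contMDiffAt
    ((isOpen_slit_inter (trivializationAt (Fib m) E w.proj).open_baseSet).mem_nhds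
      ⟨hw, FiberBundle.mem_baseSet_trivializationAt' w.proj⟩)

lemma IsSmooth.add {A : LieAlgebroid n m E} {X Y : A.Sec} (hX : A.IsSmooth X)
    (hY : A.IsSmooth Y) : A.IsSmooth (fun w => X w + Y w) := by
  refine isSmooth_of_coeff (fun w hw i => ?_) (hX.2.add_section hY.2)
  refine ((hX.contMDiffAt_frameAt_coeff hw i).add
    (hY.contMDiffAt_frameAt_coeff hw i)).congr_of_eventuallyEq (Eventually.of_forall fun p => ?_)
  exact map_add _ _ _

lemma IsSmooth.smul {A : LieAlgebroid n m E} {X : A.Sec} (hX : A.IsSmooth X)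
    {f : TotalSpace (Fib m) E → ℝ} (hf : ContMDiffOn (totModel n m) 𝓘(ℝ, ℝ) ∞ f (slit m E)) :
    A.IsSmooth (fun w => f w • X w) := by
  refine isSmooth_of_coeff (fun w hw i => ?_) (hf.smul_section hX.2)
  refine ((hf.contMDiffAt (slit_mem_nhds hw)).mul
    (hX.contMDiffAt_frameAt_coeff hw i)).congr_of_eventuallyEq
    (Eventually.of_forall fun p => ?_)
  exact map_smul _ _ _

lemma IsSmooth.const_smul {A : LieAlgebroid n m E} {X : A.Sec} (hX : A.IsSmooth X) (c : ℝ) :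
    A.IsSmooth (fun w => c • X w) :=
  hX.smul (f := fun _ => c) contMDiffOn_const

lemma IsSmooth.sub {A : LieAlgebroid n m E} {X Y : A.Sec} (hX : A.IsSmooth X)
    (hY : A.IsSmooth Y) : A.IsSmooth (fun w => X w - Y w) :=
  (hX.add (hY.const_smul (-1))).congr fun w _ => by module

lemma IsSmooth.J {A : LieAlgebroid n m E} {X : A.Sec} (hX : A.IsSmooth X) :
    A.IsSmooth (A.JSec X) := by
  refine isSmooth_of_coeff (fun w hw i => ?_) fun w hw => ?_
  · refine (contMDiffAt_const (c := (0 : ℝ))).congr_of_eventuallyEq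
      (Eventually.of_forall fun p => ?_)
    exact map_zero _
  · exact (contMDiffAt_vlift (A.isSmooth_iff.1 hX w hw).1).contMDiffWithinAt

/-- The algebra of a change of frame s_a = P_a^i e_i. Here x, y are the coefficients of X, Y in the
frame s, dy and dx are X(Y^a) and Y(X^a), D a b i is the derivative of P_a^i along s_b, and B i j is
[e_i, e_j]. The left side is the bracket formula in the frame e, the right side the one in the frame
s with [s_a, s_b] expanded in e. -/
lemma frame_change_aux {ι W : Type*} [Fintype ι] [AddCommGroup W] [Module ℝ W]
    (x y dx dy : ι → ℝ) (P : ι → ι → ℝ) (D : ι → ι → ι → ℝ) (e : ι → W) (B : ι → ι → W) :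
    ∑ i, (∑ a, (y a * ∑ b, x b * D a b i + P a i * dy a)
        - ∑ a, (x a * ∑ b, y b * D a b i + P a i * dx a)) • e i
      + ∑ i, ∑ j, ((∑ a, x a * P a i) * ∑ b, y b * P b j) • B i j
    = ∑ a, (dy a - dx a) • ∑ i, P a i • e i
      + ∑ a, ∑ b, (x a * y b) • (∑ i, (D b a i - D a b i) • e i
        + ∑ i, ∑ j, (P a i * P b j) • B i j) := by
  have hc : ∀ f : ι → ι → ι → W, ∑ a, ∑ b, ∑ i, f a b i = ∑ i, ∑ a, ∑ b, f a b i := fun f =>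
    (Finset.sum_congr rfl fun a _ => Finset.sum_comm).trans Finset.sum_comm
  have h1 : ∑ a, (dy a - dx a) • ∑ i, P a i • e i
      = ∑ i, (∑ a, (dy a - dx a) * P a i) • e i := by
    simp only [Finset.smul_sum, Finset.sum_smul, smul_smul]
    exact Finset.sum_comm
  have h2 : ∑ a, ∑ b, (x a * y b) • ∑ i, (D b a i - D a b i) • e i
      = ∑ i, (∑ a, ∑ b, x a * y b * (D b a i - D a b i)) • e i := by
    simp only [Finset.smul_sum, Finset.sum_smul, smul_smul]
    exact hc _
  have h3 : ∑ a, ∑ b, (x a * y b) • ∑ i, ∑ j, (P a i * P b j) • B i j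
      = ∑ i, ∑ j, ((∑ a, x a * P a i) * ∑ b, y b * P b j) • B i j := by
    simp only [Finset.sum_mul_sum, Finset.smul_sum, Finset.sum_smul, smul_smul]
    rw [hc]
    refine Finset.sum_congr rfl fun i _ => (hc _).trans ?_
    refine Finset.sum_congr rfl fun j _ => Finset.sum_congr rfl fun a _ =>
      Finset.sum_congr rfl fun b _ => ?_
    congr 1
    ring
  have h4 : ∑ a, ∑ b, (x a * y b) • (∑ i, (D b a i - D a b i) • e i
        + ∑ i, ∑ j, (P a i * P b j) • B i j)
      = ∑ a, ∑ b, (x a * y b) • ∑ i, (D b a i - D a b i) • e i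
        + ∑ a, ∑ b, (x a * y b) • ∑ i, ∑ j, (P a i * P b j) • B i j := by
    simp only [← Finset.sum_add_distrib, ← smul_add]
  rw [h4, h1, h2, h3, ← add_assoc]
  refine congrArg₂ (· + ·) ?_ rfl
  rw [← Finset.sum_add_distrib]
  refine Finset.sum_congr rfl fun i _ => ?_
  rw [← add_smul]
  refine congrArg (· • e i) ?_
  have h5 : ∑ a, ∑ b, x a * y b * D b a i = ∑ a, y a * ∑ b, x b * D a b i := by
    rw [Finset.sum_comm]
    simp only [Finset.mul_sum]
    exact Finset.sum_congr rfl fun a _ => Finset.sum_congr rfl fun b _ => by ring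
  have h6 : ∑ a, ∑ b, x a * y b * D a b i = ∑ a, x a * ∑ b, y b * D a b i := by
    simp only [Finset.mul_sum, mul_assoc]
  simp only [mul_sub, sub_mul, Finset.sum_sub_distrib, Finset.sum_add_distrib, h5, h6,
    mul_comm (P _ i)]
  ring

/-- The `E`-component of the bracket in an arbitrary local frame. -/
lemma lieFst_frame [T2Space M] (A : LieAlgebroid n m E) {X Y : A.Sec} (hX : A.IsSmooth X)
    (hY : A.IsSmooth Y) {w : TotalSpace (Fib m) E} (hw : w ∈ slit m E)
    {s : Fin m → ∀ x : M, E x} {U : Set M} (hU : IsOpen U)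
    (hs : IsLocalFrameOn (𝓡 n) (Fib m) ∞ s U) (hwU : w.proj ∈ U) :
    A.lieFst X Y w
      = ∑ a, (A.along X (fun p => hs.coeff a p.proj (Y p).1.1) w
          - A.along Y (fun p => hs.coeff a p.proj (X p).1.1) w) • s a w.proj
        + ∑ a, ∑ b, (hs.coeff a w.proj (X w).1.1 * hs.coeff b w.proj (Y w).1.1) •
          A.localBracket (s a) (s b) w.proj := by
  set e := trivializationAt (Fib m) E w.proj with he
  have hwe : w.proj ∈ e.baseSet := FiberBundle.mem_baseSet_trivializationAt' w.proj
  set fr := isLocalFrameOn_frameAt (n := n) (m := m) (E := E) w.proj with hfr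
  set P : Fin m → Fin m → M → ℝ := fun a i x => fr.coeff i x (s a x) with hP
  have hPs : ∀ a i, MDifferentiableAt (𝓡 n) 𝓘(ℝ, ℝ) (P a i) w.proj := fun a i =>
    ((contMDiffOn_coeff e.open_baseSet fr (hs.contMDiffOn a) i).contMDiffAt
      ((e.open_baseSet.inter hU).mem_nhds ⟨hwe, hwU⟩)).mdifferentiableAt (by simp)
  have hco : ∀ (Z : A.Sec) (p : TotalSpace (Fib m) E), p.proj ∈ U ∩ e.baseSet → ∀ i,
      frameCoeff m E w.proj i ⟨p.proj, (Z p).1.1⟩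
        = ∑ a, hs.coeff a p.proj (Z p).1.1 * P a i p.proj := by
    intro Z p hp i
    rw [frameCoeff_eq_coeff (n := n) (p := ⟨p.proj, (Z p).1.1⟩) hp.2]
    change fr.coeff i p.proj (Z p).1.1 = _
    conv_lhs => rw [← sum_coeff_smul hs hp.1 (Z p).1.1, map_sum]
    exact Finset.sum_congr rfl fun a _ => by rw [map_smul, smul_eq_mul]
  -- The vector part of Z projects to σ of its E-part, so on functions pulled back from M the
  -- derivative along Z depends only on the coefficients of Z.
  have hanch : ∀ (Z : A.Sec) (f : M → ℝ), MDifferentiableAt (𝓡 n) 𝓘(ℝ, ℝ) f w.proj →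
      mvfderiv (totModel n m) (fun p => f p.proj) w (Z w).1.2
        = ∑ b, hs.coeff b w.proj (Z w).1.1 *
          mvfderiv (𝓡 n) f w.proj (A.anchor w.proj (s b w.proj)) := by
    intro Z f hf
    refine (mvfderiv_comp_apply w hf (mdifferentiableAt_proj w) (Z w).1.2).trans ?_
    rw [A.mfderiv_proj_snd, ← sum_coeff_smul hs hwU (Z w).1.1, map_sum, map_sum]
    refine Finset.sum_congr rfl fun b _ => ?_
    rw [map_smul, map_smul, sum_coeff_smul hs hwU, smul_eq_mul]
  have hder : ∀ (Z Z' : A.Sec), A.IsSmooth Z → ∀ i,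
      A.along Z' (fun p => frameCoeff m E w.proj i ⟨p.proj, (Z p).1.1⟩) w
        = ∑ a, (hs.coeff a w.proj (Z w).1.1 * ∑ b, hs.coeff b w.proj (Z' w).1.1 *
            mvfderiv (𝓡 n) (P a i) w.proj (A.anchor w.proj (s b w.proj))
          + P a i w.proj * A.along Z' (fun p => hs.coeff a p.proj (Z p).1.1) w) := by
    intro Z Z' hZ i
    have hev : (fun p => frameCoeff m E w.proj i ⟨p.proj, (Z p).1.1⟩) =ᶠ[𝓝 w]
        fun p => ∑ a, hs.coeff a p.proj (Z p).1.1 * P a i p.proj := by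
      filter_upwards [(isOpen_proj_preimage (hU.inter e.open_baseSet)).mem_nhds
        (show w ∈ _ from ⟨hwU, hwe⟩)] with p hp
      exact hco Z p hp i
    rw [along, mvfderiv_congr hev, (mvfderiv_sum_mul Finset.univ
      (fun a p => hs.coeff a p.proj (Z p).1.1) (fun a p => P a i p.proj) w
      (fun a => hZ.mdifferentiableAt_coeff hU hs a hw hwU)
      (fun a => (hPs a i).comp w (mdifferentiableAt_proj w))).2]
    refine Finset.sum_congr rfl fun a _ => ?_
    rw [hanch Z' (P a i) (hPs a i)]
    rfl
  -- The derivatives of the transition matrix contained in [s_a, s_b] account exactly for those that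
  -- `hder` produces.
  have hloc : ∀ a b, A.localBracket (s a) (s b) w.proj
      = ∑ i, (mvfderiv (𝓡 n) (P b i) w.proj (A.anchor w.proj (s a w.proj))
          - mvfderiv (𝓡 n) (P a i) w.proj (A.anchor w.proj (s b w.proj))) •
            frameAt m E w.proj i w.proj
        + ∑ i, ∑ j, (P a i w.proj * P b j w.proj) •
          A.localBracket (frameAt m E w.proj i) (frameAt m E w.proj j) w.proj := fun a b =>
    A.localBracket_frame hU hwU (hs.contMDiffOn a) (hs.contMDiffOn b) e.open_baseSet hwe fr
  have hsP : ∀ a, s a w.proj = ∑ i, P a i w.proj • frameAt m E w.proj i w.proj := fun a =>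
    (sum_coeff_smul fr hwe (s a w.proj)).symm
  simp only [lieFst, hder Y X hY, hder X Y hX, hco X w ⟨hwU, hwe⟩, hco Y w ⟨hwU, hwe⟩, hloc]
  rw [frame_change_aux (fun a => hs.coeff a w.proj (X w).1.1)
    (fun a => hs.coeff a w.proj (Y w).1.1)
    (fun a => A.along Y (fun p => hs.coeff a p.proj (X p).1.1) w)
    (fun a => A.along X (fun p => hs.coeff a p.proj (Y p).1.1) w)
    (fun a i => P a i w.proj)
    (fun a b i => mvfderiv (𝓡 n) (P a i) w.proj (A.anchor w.proj (s b w.proj)))]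
  simp only [← hsP]

lemma prol_ext {A : LieAlgebroid n m E} {w : TotalSpace (Fib m) E} {p q : A.Prol w}
    {s : Fin m → ∀ x : M, E x} {U : Set M} (hs : IsLocalFrameOn (𝓡 n) (Fib m) ∞ s U)
    (hw : w.proj ∈ U) (h1 : ∀ c, hs.coeff c w.proj p.1.1 = hs.coeff c w.proj q.1.1)
    (h2 : p.1.2 = q.1.2) : p = q :=
  Subtype.ext (Prod.ext (ext_coeff hs hw h1) h2)

/-! ### Calculus of the bracket: coefficients, smoothness and the rules in the second argument -/

section Bracket

variable [T2Space M] {A : LieAlgebroid n m E} {X Y Z : A.Sec} {w : TotalSpace (Fib m) E}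

/-- `lie` has the default value 0 where the pair of components leaves 𝒯E; `lie_mem` rules this out
for smooth sections off the zero section. -/
lemma lie_fst (hX : A.IsSmooth X) (hY : A.IsSmooth Y) (hw : w ∈ slit m E) :
    (A.lie X Y w).1.1 = A.lieFst X Y w := by
  rw [lie, dif_pos (A.lie_mem hX hY hw)]

lemma lie_snd (hX : A.IsSmooth X) (hY : A.IsSmooth Y) (hw : w ∈ slit m E) :
    (A.lie X Y w).1.2 = A.lieSnd X Y w := by
  rw [lie, dif_pos (A.lie_mem hX hY hw)]

/-- The coefficients of the bracket in a local frame. -/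
lemma coeff_lie (hX : A.IsSmooth X) (hY : A.IsSmooth Y) (hw : w ∈ slit m E)
    {s : Fin m → ∀ x : M, E x} {U : Set M} (hU : IsOpen U)
    (hs : IsLocalFrameOn (𝓡 n) (Fib m) ∞ s U) (hwU : w.proj ∈ U) (c : Fin m) :
    hs.coeff c w.proj (A.lie X Y w).1.1
      = A.along X (fun p => hs.coeff c p.proj (Y p).1.1) w
        - A.along Y (fun p => hs.coeff c p.proj (X p).1.1) w
        + ∑ a, ∑ b, hs.coeff a w.proj (X w).1.1 * hs.coeff b w.proj (Y w).1.1 *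
          A.structFun hs a b c w.proj := by
  rw [lie_fst hX hY hw, A.lieFst_frame hX hY hw hU hs hwU, map_add, coeff_sum_smul hs hwU]
  simp only [map_sum, map_smul, smul_eq_mul]
  rfl

/-- `lieFst` uses a different frame at each point. By `coeff_lie`, its coefficients in one frame
fixed near w are given throughout a neighbourhood by a single expression, which is visibly smooth.
-/
lemma IsSmooth.lie (hX : A.IsSmooth X) (hY : A.IsSmooth Y) : A.IsSmooth (A.lie X Y) := by
  refine isSmooth_of_coeff (fun w hw i => ?_) fun w hw => ?_
  · set e := trivializationAt (Fib m) E w.proj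
    have hwe : w.proj ∈ e.baseSet := FiberBundle.mem_baseSet_trivializationAt' w.proj
    set fr := isLocalFrameOn_frameAt (n := n) (m := m) (E := E) w.proj
    have hO := isOpen_slit_inter (m := m) (E := E) e.open_baseSet
    have hal : ∀ {Z Z' : A.Sec}, A.IsSmooth Z → A.IsSmooth Z' →
        ContMDiffAt (totModel n m) 𝓘(ℝ, ℝ) ∞
          (A.along Z (fun p => fr.coeff i p.proj (Z' p).1.1)) w := fun hZ hZ' =>
      (hZ.contMDiffOn_along hO inter_subset_left
        (hZ'.contMDiffOn_coeff e.open_baseSet fr i)).contMDiffAt (hO.mem_nhds ⟨hw, hwe⟩)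
    have hst : ∀ a b, ContMDiffAt (totModel n m) 𝓘(ℝ, ℝ) ∞
        (fun p : TotalSpace (Fib m) E => A.structFun fr a b i p.proj) w := by
      intro a b
      have h1 := A.contMDiffAt_localBracket e.open_baseSet hwe (fr.contMDiffOn a)
        (fr.contMDiffOn b)
      have h2 := (contMDiffOn_yCoord e.open_baseSet fr i).contMDiffAt
        (x := (⟨w.proj, A.localBracket (frameAt m E w.proj a) (frameAt m E w.proj b) w.proj⟩ :
          TotalSpace (Fib m) E)) ((isOpen_proj_preimage e.open_baseSet).mem_nhds hwe)
      exact (h2.comp w.proj h1).comp w (contMDiff_proj E w)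
    have hsum : ContMDiffAt (totModel n m) 𝓘(ℝ, ℝ) ∞ (fun p =>
        A.along X (fun p => fr.coeff i p.proj (Y p).1.1) p
        - A.along Y (fun p => fr.coeff i p.proj (X p).1.1) p
        + ∑ a, ∑ b, fr.coeff a p.proj (X p).1.1 * fr.coeff b p.proj (Y p).1.1 *
          A.structFun fr a b i p.proj) w :=
      ((hal hX hY).sub (hal hY hX)).add (ContMDiffAt.sum fun a _ => ContMDiffAt.sum fun b _ =>
        ((hX.contMDiffAt_frameAt_coeff hw a).mul (hY.contMDiffAt_frameAt_coeff hw b)).mul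
          (hst a b))
    refine hsum.congr_of_eventuallyEq ?_
    filter_upwards [hO.mem_nhds ⟨hw, hwe⟩] with p hp
    exact coeff_lie hX hY hp.1 e.open_baseSet fr hp.2 i
  · have : IsManifold (totModel n m) (((⊤ : ℕ∞) : WithTop ℕ∞) + 1) (TotalSpace (Fib m) E) :=
      inferInstanceAs (IsManifold (totModel n m) ∞ (TotalSpace (Fib m) E))
    have : IsManifold (totModel n m) (minSmoothness ℝ 2) (TotalSpace (Fib m) E) := by
      rw [minSmoothness_of_isRCLikeNormedField]; infer_instance
    have h := ContMDiffAt.mlieBracket_vectorField (m := ⊤) (n := ⊤)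
      (A.isSmooth_iff.1 hX w hw).2 (A.isSmooth_iff.1 hY w hw).2
      (by rw [minSmoothness_of_isRCLikeNormedField]; rfl)
    refine (h.congr_of_eventuallyEq ?_).contMDiffWithinAt
    filter_upwards [slit_mem_nhds hw] with p hp
    rw [lie_snd hX hY hp]
    rfl

/-- E∖{0} is open and the bracket sees only germs, so values on the zero section play no role.
Identities between projectors, valid only on E∖{0}, can thereby be used inside a bracket. -/
lemma lie_congr_right (hX : A.IsSmooth X) (hY : A.IsSmooth Y) (h : ∀ w ∈ slit m E, Z w = Y w)
    (hw : w ∈ slit m E) : A.lie X Z w = A.lie X Y w := by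
  have hZ := hY.congr h
  have hev : ∀ᶠ p in 𝓝 w, Z p = Y p := by
    filter_upwards [slit_mem_nhds hw] with p hp using h p hp
  have hwe : w.proj ∈ (trivializationAt (Fib m) E w.proj).baseSet :=
    FiberBundle.mem_baseSet_trivializationAt' w.proj
  refine prol_ext (isLocalFrameOn_frameAt w.proj) hwe (fun c => ?_) ?_
  · rw [coeff_lie hX hY hw (trivializationAt (Fib m) E w.proj).open_baseSet _ hwe,
      coeff_lie hX hZ hw (trivializationAt (Fib m) E w.proj).open_baseSet _ hwe, along, along,
      along, along, h w hw]
    congr 2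
    exact mvfderiv_congr (hev.mono fun p hp => by rw [hp]) _
  · rw [lie_snd hX hY hw, lie_snd hX hZ hw]
    exact Filter.EventuallyEq.mlieBracket_vectorField_eq (EventuallyEq.refl _ _)
      (hev.mono fun p hp => congrArg (fun q : A.Prol p => q.1.2) hp)

lemma lie_add_right (hX : A.IsSmooth X) (hY : A.IsSmooth Y) (hZ : A.IsSmooth Z)
    (hw : w ∈ slit m E) : A.lie X (fun p => Y p + Z p) w = A.lie X Y w + A.lie X Z w := by
  have hwe : w.proj ∈ (trivializationAt (Fib m) E w.proj).baseSet :=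
    FiberBundle.mem_baseSet_trivializationAt' w.proj
  have hU := (trivializationAt (Fib m) E w.proj).open_baseSet
  set fr := isLocalFrameOn_frameAt (n := n) (m := m) (E := E) w.proj
  refine prol_ext fr hwe (fun c => ?_) ?_
  · have e : fr.coeff c w.proj (A.lie X Y w + A.lie X Z w).1.1
        = fr.coeff c w.proj (A.lie X Y w).1.1 + fr.coeff c w.proj (A.lie X Z w).1.1 :=
      map_add _ _ _
    rw [e, coeff_lie hX (hY.add hZ) hw hU fr hwe, coeff_lie hX hY hw hU fr hwe,
      coeff_lie hX hZ hw hU fr hwe]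
    have e1 : A.along X (fun p => fr.coeff c p.proj (Y p + Z p).1.1) w
        = A.along X (fun p => fr.coeff c p.proj (Y p).1.1) w
          + A.along X (fun p => fr.coeff c p.proj (Z p).1.1) w := by
      have h := mvfderiv_fun_add (hY.mdifferentiableAt_coeff hU fr c hw hwe)
        (hZ.mdifferentiableAt_coeff hU fr c hw hwe)
      refine Eq.trans (mvfderiv_congr (Eventually.of_forall fun p => ?_) _)
        (congrArg (fun L : TangentSpace (totModel n m) w →L[ℝ] ℝ => L (X w).1.2) h)
      exact map_add _ _ _
    have e2 : A.along (fun p => Y p + Z p) (fun p => fr.coeff c p.proj (X p).1.1) w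
        = A.along Y (fun p => fr.coeff c p.proj (X p).1.1) w
          + A.along Z (fun p => fr.coeff c p.proj (X p).1.1) w := map_add _ _ _
    have e3 : ∀ b, fr.coeff b w.proj (Y w + Z w).1.1
        = fr.coeff b w.proj (Y w).1.1 + fr.coeff b w.proj (Z w).1.1 := fun b => map_add _ _ _
    simp only [e1, e2, e3, mul_add, add_mul, Finset.sum_add_distrib]
    ring
  · rw [lie_snd hX (hY.add hZ) hw]
    refine (VectorField.mlieBracket_add_right (hY.mdifferentiableAt_snd hw)
      (hZ.mdifferentiableAt_snd hw)).trans ?_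
    refine congrArg₂ (· + ·) ?_ ?_
    · rw [lie_snd hX hY hw]; rfl
    · rw [lie_snd hX hZ hw]; rfl

lemma lie_smul_right (hX : A.IsSmooth X) (hY : A.IsSmooth Y) {f : TotalSpace (Fib m) E → ℝ}
    (hf : ContMDiffOn (totModel n m) 𝓘(ℝ, ℝ) ∞ f (slit m E))
    (hw : w ∈ slit m E) :
    A.lie X (fun p => f p • Y p) w = A.along X f w • Y w + f w • A.lie X Y w := by
  have hwe : w.proj ∈ (trivializationAt (Fib m) E w.proj).baseSet :=
    FiberBundle.mem_baseSet_trivializationAt' w.proj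
  have hU := (trivializationAt (Fib m) E w.proj).open_baseSet
  have hfd : MDifferentiableAt (totModel n m) 𝓘(ℝ, ℝ) f w :=
    (hf.contMDiffAt (slit_mem_nhds hw)).mdifferentiableAt (by simp)
  set fr := isLocalFrameOn_frameAt (n := n) (m := m) (E := E) w.proj
  refine prol_ext fr hwe (fun c => ?_) ?_
  · have e : fr.coeff c w.proj (A.along X f w • Y w + f w • A.lie X Y w).1.1
        = A.along X f w * fr.coeff c w.proj (Y w).1.1
          + f w * fr.coeff c w.proj (A.lie X Y w).1.1 := by
      rw [← smul_eq_mul, ← smul_eq_mul, ← map_smul, ← map_smul, ← map_add]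
      rfl
    rw [e, coeff_lie hX (hY.smul hf) hw hU fr hwe, coeff_lie hX hY hw hU fr hwe]
    have e1 : A.along X (fun p => fr.coeff c p.proj (f p • Y p).1.1) w
        = f w * A.along X (fun p => fr.coeff c p.proj (Y p).1.1) w
          + A.along X f w * fr.coeff c w.proj (Y w).1.1 := by
      have h := mvfderiv_fun_mul hfd (hY.mdifferentiableAt_coeff hU fr c hw hwe)
      refine (mvfderiv_congr (Eventually.of_forall fun p => ?_) _).trans
        ((congrArg (fun L : TangentSpace (totModel n m) w →L[ℝ] ℝ => L (X w).1.2) h).trans ?_)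
      · exact map_smul _ _ _
      · simp [along, mul_comm]
    have e2 : A.along (fun p => f p • Y p) (fun p => fr.coeff c p.proj (X p).1.1) w
        = f w * A.along Y (fun p => fr.coeff c p.proj (X p).1.1) w := map_smul _ _ _
    have e3 : ∀ b, fr.coeff b w.proj (f w • Y w).1.1 = f w * fr.coeff b w.proj (Y w).1.1 :=
      fun b => map_smul _ _ _
    simp only [e1, e2, e3, mul_add, mul_sub, Finset.mul_sum]
    have e4 : ∀ a b : Fin m, fr.coeff a w.proj (X w).1.1 * (f w * fr.coeff b w.proj (Y w).1.1) *
        A.structFun fr a b c w.proj = f w * (fr.coeff a w.proj (X w).1.1 *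
          fr.coeff b w.proj (Y w).1.1 * A.structFun fr a b c w.proj) := fun a b => by ring
    simp only [e4]
    ring
  · rw [lie_snd hX (hY.smul hf) hw]
    refine (VectorField.mlieBracket_smul_right (f := f) hfd (hY.mdifferentiableAt_snd hw)).trans ?_
    refine congrArg₂ (· + ·) rfl ?_
    rw [Submodule.coe_smul, Prod.smul_snd, lie_snd hX hY hw]; rfl

lemma lie_sub_right (hX : A.IsSmooth X) (hY : A.IsSmooth Y) (hZ : A.IsSmooth Z)
    (hw : w ∈ slit m E) : A.lie X (fun p => Y p - Z p) w = A.lie X Y w - A.lie X Z w := by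
  have h := lie_add_right hX (hY.sub hZ) hZ hw
  rw [lie_congr_right hX hY (fun p _ => sub_add_cancel _ _) hw] at h
  exact eq_sub_of_add_eq h.symm

end Bracket

/-! ### Vertical sections and the vertical endomorphism -/

section Vertical

variable {A : LieAlgebroid n m E} {w : TotalSpace (Fib m) E}

lemma J_add (p q : A.Prol w) : A.J (p + q) = A.J p + A.J q :=
  Subtype.ext (Prod.ext (add_zero _).symm (vlift_add w _ _))

lemma J_smul (c : ℝ) (p : A.Prol w) : A.J (c • p) = c • A.J p :=
  Subtype.ext (Prod.ext (smul_zero c).symm (vlift_smul w c _))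

lemma J_sub (p q : A.Prol w) : A.J (p - q) = A.J p - A.J q := by
  have h := A.J_add (p - q) q
  rw [sub_add_cancel] at h
  exact eq_sub_of_add_eq h.symm

lemma J_eq_zero_iff {p : A.Prol w} : A.J p = 0 ↔ p.1.1 = 0 := by
  constructor
  · intro h
    apply vlift_injective (n := n) w
    have h1 : (A.J p).1.2 = 0 := by rw [h]; rfl
    have h2 : vlift (n := n) w (0 : E w.proj) = 0 := by
      rw [← zero_smul ℝ (0 : E w.proj), vlift_smul, zero_smul]
    exact h1.trans h2.symm
  · intro h
    have h2 : vlift (n := n) w (0 : E w.proj) = 0 := by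
      rw [← zero_smul ℝ (0 : E w.proj), vlift_smul, zero_smul]
    refine Subtype.ext (Prod.ext rfl ?_)
    change vlift w p.1.1 = 0
    rw [h, h2]

lemma J_J (p : A.Prol w) : A.J (A.J p) = 0 := J_eq_zero_iff.2 rfl

/-- The vertical lift is injective, so JS = ℂ pins down the E-component of S: its coefficients in
any frame are the coordinates y^α. -/
lemma IsSemispray.fst {S : A.Sec} (hS : A.IsSemispray S) (hw : w ∈ slit m E) :
    (S w).1.1 = w.2 :=
  vlift_injective (n := n) w (congrArg (fun p : A.Prol w => p.1.2) (hS.2 w hw))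

/-- `J [S, V] = -V` for every vertical section `V`. -/
lemma IsSemispray.J_lie_vertical [T2Space M] {S V : A.Sec} (hS : A.IsSemispray S)
    (hV : A.IsSmooth V) (h0 : ∀ w ∈ slit m E, (V w).1.1 = 0) (hw : w ∈ slit m E) :
    A.J (A.lie S V w) = -V w := by
  have hwe : w.proj ∈ (trivializationAt (Fib m) E w.proj).baseSet :=
    FiberBundle.mem_baseSet_trivializationAt' w.proj
  have hU := (trivializationAt (Fib m) E w.proj).open_baseSet
  set fr := isLocalFrameOn_frameAt (n := n) (m := m) (E := E) w.proj
  have hz : mfderiv (totModel n m) (𝓡 n) (TotalSpace.proj : TotalSpace (Fib m) E → M) w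
      (V w).1.2 = 0 := by
    rw [A.mfderiv_proj_snd, h0 w hw, map_zero]
  have hc : ∀ c, fr.coeff c w.proj (A.lie S V w).1.1
      = -mvfderiv (totModel n m) (frameCoeff m E w.proj c) w (V w).1.2 := by
    intro c
    rw [coeff_lie hS.1 hV hw hU fr hwe, h0 w hw]
    have e1 : A.along S (fun p => fr.coeff c p.proj (V p).1.1) w = 0 := by
      refine (mvfderiv_congr (g := fun _ => (0 : ℝ)) ?_ _).trans ?_
      · filter_upwards [slit_mem_nhds hw] with p hp
        rw [h0 p hp, map_zero]
      · rw [mvfderiv_const]; rfl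
    -- The c-th coefficient of S is the coordinate function y^c, so its derivative along V is the
    -- c-th fibre coordinate of V. No other term of the bracket survives, since V has zero
    -- E-component.
    have e2 : A.along V (fun p => fr.coeff c p.proj (S p).1.1) w
        = mvfderiv (totModel n m) (frameCoeff m E w.proj c) w (V w).1.2 := by
      refine mvfderiv_congr ?_ _
      filter_upwards [slit_mem_nhds hw, frameCoeff_eventuallyEq (n := n) hwe c] with p hp hp'
      rw [hp', hS.fst hp]
      rfl
    rw [e1, e2]
    simp
  have h1 : (A.lie S V w).1.1 = (-1 : ℝ) • ∑ i, mvfderiv (totModel n m)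
      (frameCoeff m E w.proj i) w (V w).1.2 • frameAt m E w.proj i w.proj := by
    refine ext_coeff fr hwe fun c => ?_
    rw [hc, map_smul, coeff_sum_smul fr hwe]
    simp
  refine Subtype.ext (Prod.ext ?_ ?_)
  · change (0 : E w.proj) = -(V w).1.1
    rw [h0 w hw, neg_zero]
  · change vlift w (A.lie S V w).1.1 = -(V w).1.2
    rw [h1, vlift_smul, vlift_coeff hz, neg_one_smul]

/-- Every element of `𝒯E∖{0}` can be modified by a vertical one so that it extends to a smooth
section. -/
lemma IsSemispray.exists_isSmooth_fst [T2Space M] {S : A.Sec} (hS : A.IsSemispray S)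
    (hw : w ∈ slit m E) (a : E w.proj) : ∃ X : A.Sec, A.IsSmooth X ∧ (X w).1.1 = a := by
  have hwe : w.proj ∈ (trivializationAt (Fib m) E w.proj).baseSet :=
    FiberBundle.mem_baseSet_trivializationAt' w.proj
  obtain ⟨s, hs, hss⟩ := FiberBundle.exists_contMDiffOn_extend (k := ∞) (𝓡 n) (Fib m) a
  obtain ⟨U, hUs, hU, hwU⟩ := mem_nhds_iff.1 hs
  obtain ⟨σ, hσ⟩ := exists_global_extension (n := n) hU hwU (hss.mono hUs)
  set V : A.Sec := fun p => ⟨(0, vlift p (σ p.proj)), A.vlift_mem p _⟩ with hVdef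
  have hV : A.IsSmooth V := by
    refine isSmooth_of_coeff (fun p hp i => ?_) fun p hp => ?_
    · refine (contMDiffAt_const (c := (0 : ℝ))).congr_of_eventuallyEq
        (Eventually.of_forall fun p => ?_)
      exact map_zero _
    · exact (contMDiffAt_vlift (u := fun p => σ p.proj)
        ((σ.contMDiff _).comp p (contMDiff_proj E p))).contMDiffWithinAt
  -- The witness is -[S, V], with V the vertical lift of a section σ of E through a: J[S, V] = -V
  -- says that the E-component of -[S, V] is σ.
  refine ⟨_, (hS.1.lie hV).const_smul (-1), ?_⟩
  have h := hS.J_lie_vertical hV (fun _ _ => rfl) hw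
  apply vlift_injective (n := n) w
  have h2 : vlift w (A.lie S V w).1.1 = -vlift (n := n) w (σ w.proj) :=
    congrArg (fun p : A.Prol w => p.1.2) h
  change vlift w ((-1 : ℝ) • (A.lie S V w).1.1) = _
  rw [vlift_smul, h2, hσ.self_of_nhds, FiberBundle.extend_apply_self, neg_one_smul, neg_neg]

end Vertical

/-! ### Projectors of a nonlinear connection and the dynamical covariant derivative -/

lemma lie_of_eq_zero [T2Space M] {A : LieAlgebroid n m E} {X Y : A.Sec} (hX : A.IsSmooth X)
    (hY : A.IsSmooth Y) (h : ∀ w ∈ slit m E, Y w = 0) {w : TotalSpace (Fib m) E}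
    (hw : w ∈ slit m E) : A.lie X Y w = 0 := by
  rw [lie_congr_right hX (hY.sub hY) (fun p hp => by rw [h p hp, sub_self]) hw,
    lie_sub_right hX hY hY hw, sub_self]

lemma localBracket_skew [T2Space M] (A : LieAlgebroid n m E) {s t : ∀ y : M, E y} {U : Set M}
    {x : M} (hU : IsOpen U) (hx : x ∈ U)
    (hs : ContMDiffOn (𝓡 n) (totModel n m) ∞ (fun y => (⟨y, s y⟩ : TotalSpace (Fib m) E)) U)
    (ht : ContMDiffOn (𝓡 n) (totModel n m) ∞ (fun y => (⟨y, t y⟩ : TotalSpace (Fib m) E)) U) :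
    A.localBracket s t x = -A.localBracket t s x := by
  obtain ⟨σ, hσ⟩ := exists_global_extension (n := n) hU hx hs
  obtain ⟨τ, hτ⟩ := exists_global_extension (n := n) hU hx ht
  rw [A.localBracket_eq hσ hτ, A.localBracket_eq hτ hσ, A.bracket_skew]
  rfl

namespace NonlinearConnection

variable {A : LieAlgebroid n m E} (N : A.NonlinearConnection) {w : TotalSpace (Fib m) E}

/-- The horizontal projector on the fibres. -/
def hor (w : TotalSpace (Fib m) E) : A.Prol w →ₗ[ℝ] A.Prol w :=
  (1 / 2 : ℝ) • (LinearMap.id + N.toFun w)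

/-- The vertical projector on the fibres. -/
def ver (w : TotalSpace (Fib m) E) : A.Prol w →ₗ[ℝ] A.Prol w :=
  (1 / 2 : ℝ) • (LinearMap.id - N.toFun w)

lemma h_apply (X : A.Sec) (w : TotalSpace (Fib m) E) : N.h X w = N.hor w (X w) := rfl

lemma v_apply (X : A.Sec) (w : TotalSpace (Fib m) E) : N.v X w = N.ver w (X w) := rfl

lemma hor_apply (p : A.Prol w) : N.hor w p = (1 / 2 : ℝ) • (p + N.toFun w p) := rfl

lemma ver_apply (p : A.Prol w) : N.ver w p = (1 / 2 : ℝ) • (p - N.toFun w p) := rfl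

lemma hor_add_ver (p : A.Prol w) : N.hor w p + N.ver w p = p := by
  rw [hor_apply, ver_apply]
  module

lemma hor_sub_ver (p : A.Prol w) : N.hor w p - N.ver w p = N.toFun w p := by
  rw [hor_apply, ver_apply]
  module

lemma toFun_of_vertical (hw : w ∈ slit m E) {p : A.Prol w} (hp : p.1.1 = 0) :
    N.toFun w p = -p := by
  have h : p + N.toFun w p = 0 := (N.mem_ker_iff w hw p).2 hp
  exact (neg_eq_of_add_eq_zero_right h).symm

lemma toFun_toFun (hw : w ∈ slit m E) (p : A.Prol w) : N.toFun w (N.toFun w p) = p :=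
  congrArg (fun L : A.Prol w →ₗ[ℝ] A.Prol w => L p) (N.sq w hw)

/-- 𝒩p - p lies in ker (Id + 𝒩) because 𝒩² = Id, hence it is vertical. -/
lemma toFun_fst (hw : w ∈ slit m E) (p : A.Prol w) : (N.toFun w p).1.1 = p.1.1 := by
  have h : (N.toFun w p - p).1.1 = 0 := by
    refine (N.mem_ker_iff w hw _).1 ?_
    change (N.toFun w p - p) + N.toFun w (N.toFun w p - p) = 0
    rw [map_sub, N.toFun_toFun hw]
    abel
  exact sub_eq_zero.1 h

lemma ver_fst (hw : w ∈ slit m E) (p : A.Prol w) : (N.ver w p).1.1 = 0 := by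
  change (1 / 2 : ℝ) • (p.1.1 - (N.toFun w p).1.1) = 0
  rw [N.toFun_fst hw, sub_self, smul_zero]

lemma hor_fst (hw : w ∈ slit m E) (p : A.Prol w) : (N.hor w p).1.1 = p.1.1 := by
  have h : (N.hor w p).1.1 + (N.ver w p).1.1 = p.1.1 :=
    congrArg (fun q : A.Prol w => q.1.1) (N.hor_add_ver p)
  rwa [N.ver_fst hw, add_zero] at h

lemma hor_of_vertical (hw : w ∈ slit m E) {p : A.Prol w} (hp : p.1.1 = 0) : N.hor w p = 0 := by
  rw [hor_apply, N.toFun_of_vertical hw hp, add_neg_cancel, smul_zero]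

lemma ver_of_vertical (hw : w ∈ slit m E) {p : A.Prol w} (hp : p.1.1 = 0) : N.ver w p = p := by
  have h := N.hor_add_ver p
  rwa [N.hor_of_vertical hw hp, zero_add] at h

lemma J_hor (hw : w ∈ slit m E) (p : A.Prol w) : A.J (N.hor w p) = A.J p := by
  rw [← sub_eq_zero, ← J_sub, J_eq_zero_iff]
  exact sub_eq_zero.2 (N.hor_fst hw p)

lemma J_ver (hw : w ∈ slit m E) (p : A.Prol w) : A.J (N.ver w p) = 0 :=
  J_eq_zero_iff.2 (N.ver_fst hw p)

lemma toFun_hor (hw : w ∈ slit m E) (p : A.Prol w) : N.toFun w (N.hor w p) = N.hor w p := by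
  rw [hor_apply, map_smul, map_add, N.toFun_toFun hw, add_comm]

lemma isSmooth_h {X : A.Sec} (hX : A.IsSmooth X) : A.IsSmooth (N.h X) :=
  (hX.add (N.smooth X hX)).const_smul _

lemma isSmooth_v {X : A.Sec} (hX : A.IsSmooth X) : A.IsSmooth (N.v X) :=
  (hX.sub (N.smooth X hX)).const_smul _

variable [T2Space M] {S X Y : A.Sec}

lemma isSmooth_nabla (hS : A.IsSmooth S) (hX : A.IsSmooth X) : A.IsSmooth (N.nabla S X) :=
  (N.isSmooth_h (hS.lie (N.isSmooth_h hX))).add (N.isSmooth_v (hS.lie (N.isSmooth_v hX)))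

lemma nabla_apply : N.nabla S X w
    = N.hor w (A.lie S (N.h X) w) + N.ver w (A.lie S (N.v X) w) := rfl

lemma nabla_congr (hS : A.IsSmooth S) (hX : A.IsSmooth X) (h : ∀ w ∈ slit m E, Y w = X w)
    (hw : w ∈ slit m E) : N.nabla S Y w = N.nabla S X w := by
  rw [nabla_apply, nabla_apply, lie_congr_right (Z := N.h Y) hS (N.isSmooth_h hX) (fun p hp => ?_) hw,
    lie_congr_right (Z := N.v Y) hS (N.isSmooth_v hX) (fun p hp => ?_) hw]
  · rw [v_apply, v_apply, h p hp]
  · rw [h_apply, h_apply, h p hp]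

lemma nabla_add (hS : A.IsSmooth S) (hX : A.IsSmooth X) (hY : A.IsSmooth Y) (hw : w ∈ slit m E) :
    N.nabla S (fun p => X p + Y p) w = N.nabla S X w + N.nabla S Y w := by
  rw [nabla_apply, nabla_apply, nabla_apply,
    lie_congr_right (Z := N.h fun p => X p + Y p) hS ((N.isSmooth_h hX).add (N.isSmooth_h hY)) (fun p _ => ?_)
      hw,
    lie_congr_right (Z := N.v fun p => X p + Y p) hS ((N.isSmooth_v hX).add (N.isSmooth_v hY)) (fun p _ => ?_) hw,
    lie_add_right hS (N.isSmooth_h hX) (N.isSmooth_h hY) hw,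
    lie_add_right hS (N.isSmooth_v hX) (N.isSmooth_v hY) hw, map_add, map_add]
  · abel
  · simp only [v_apply, map_add]
  · simp only [h_apply, map_add]

lemma hor_hor (hw : w ∈ slit m E) (p : A.Prol w) : N.hor w (N.hor w p) = N.hor w p := by
  conv_lhs => rw [hor_apply, N.toFun_hor hw]
  module

/-- The projectors are idempotent, so the derivative terms are S(f) hX and S(f) vX, which recombine
to S(f) X. No Newtonoid condition is involved. -/
lemma nabla_smul (hS : A.IsSmooth S) (hX : A.IsSmooth X) {f : TotalSpace (Fib m) E → ℝ}
    (hf : ContMDiffOn (totModel n m) 𝓘(ℝ, ℝ) ∞ f (slit m E)) (hw : w ∈ slit m E) :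
    N.nabla S (fun p => f p • X p) w = A.along S f w • X w + f w • N.nabla S X w := by
  rw [nabla_apply, nabla_apply,
    lie_congr_right (Z := N.h fun p => f p • X p) hS ((N.isSmooth_h hX).smul hf) (fun p _ => ?_)
      hw,
    lie_congr_right (Z := N.v fun p => f p • X p) hS ((N.isSmooth_v hX).smul hf) (fun p _ => ?_) hw,
    lie_smul_right hS (N.isSmooth_h hX) hf hw, lie_smul_right hS (N.isSmooth_v hX) hf hw]
  · rw [map_add, map_add, map_smul, map_smul, map_smul, map_smul, h_apply, v_apply,
      N.hor_hor hw, N.ver_of_vertical hw (N.ver_fst hw (X w))]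
    conv_rhs => rw [← N.hor_add_ver (X w)]
    module
  · simp only [v_apply, map_smul]
  · simp only [h_apply, map_smul]

/-! ### The tensor L_S J + 𝒩 and its equality with ∇J -/

/-- The tensor field `L_S J + 𝒩`. -/
def lieJAdd (N : A.NonlinearConnection) (S X : A.Sec) : A.Sec := fun w =>
  A.lie S (A.JSec X) w - A.JSec (A.lie S X) w + N.toFun w (X w)

lemma lieJAdd_apply : N.lieJAdd S X w
    = A.lie S (A.JSec X) w - A.J (A.lie S X w) + N.toFun w (X w) := rfl

lemma isSmooth_lieJAdd (hS : A.IsSmooth S) (hX : A.IsSmooth X) : A.IsSmooth (N.lieJAdd S X) :=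
  ((hS.lie hX.J).sub (hS.lie hX).J).add (N.smooth X hX)

/-- By J[S, JX] = -JX, the section [S, JX] + X is killed by J and is therefore vertical. -/
lemma lie_J_fst (hS : A.IsSemispray S) (hX : A.IsSmooth X) (hw : w ∈ slit m E) :
    (A.lie S (A.JSec X) w).1.1 = -(X w).1.1 := by
  have h := hS.J_lie_vertical hX.J (fun _ _ => rfl) hw
  have h1 : A.J (A.lie S (A.JSec X) w + X w) = 0 := by
    rw [J_add, h]
    exact neg_add_cancel _
  exact eq_neg_of_add_eq_zero_left (J_eq_zero_iff.1 h1)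

/-- The E-component -X of [S, JX] cancels that of 𝒩X, and J[S, X] is vertical. Only fibre
coordinates are then left to compute. -/
lemma lieJAdd_fst (hS : A.IsSemispray S) (hX : A.IsSmooth X) (hw : w ∈ slit m E) :
    (N.lieJAdd S X w).1.1 = 0 := by
  change (A.lie S (A.JSec X) w).1.1 - 0 + (N.toFun w (X w)).1.1 = 0
  rw [lie_J_fst hS hX hw, N.toFun_fst hw, sub_zero, neg_add_cancel]

/-- Write hX = X - vX and use J[S, vX] = -vX. -/
lemma J_lie_h (hS : A.IsSemispray S) (hX : A.IsSmooth X) (hw : w ∈ slit m E) :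
    A.J (A.lie S (N.h X) w) = A.J (A.lie S X w) + N.v X w := by
  have hv := N.isSmooth_v hX
  rw [lie_congr_right hS.1 (hX.sub hv) (fun p _ => ?_) hw, lie_sub_right hS.1 hX hv hw, J_sub,
    hS.J_lie_vertical hv (fun p hp => N.ver_fst hp (X p)) hw, sub_neg_eq_add]
  rw [h_apply, v_apply]
  exact eq_sub_of_add_eq (N.hor_add_ver (X p))

lemma J_nabla (hS : A.IsSemispray S) (hX : A.IsSmooth X) (hw : w ∈ slit m E) :
    A.J (N.nabla S X w) = A.J (A.lie S X w) + N.v X w := by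
  rw [nabla_apply, J_add, N.J_hor hw, N.J_ver hw, add_zero, N.J_lie_h hS hX hw]

/-- Since h(JX) = 0 and v(JX) = JX, only v[S, JX] remains. As [S, JX] + X is vertical, h[S, JX] =
-hX, which turns v[S, JX] into [S, JX] + hX. -/
lemma nabla_J (hS : A.IsSemispray S) (hX : A.IsSmooth X) (hw : w ∈ slit m E) :
    N.nabla S (A.JSec X) w = A.lie S (A.JSec X) w + N.h X w := by
  have hJ : ∀ p ∈ slit m E, N.v (A.JSec X) p = A.JSec X p := fun p hp =>
    N.ver_of_vertical hp (p := A.JSec X p) rfl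
  have hh : N.hor w (A.lie S (A.JSec X) w + X w) = 0 := by
    refine N.hor_of_vertical hw ?_
    change (A.lie S (A.JSec X) w).1.1 + (X w).1.1 = 0
    rw [lie_J_fst hS hX hw, neg_add_cancel]
  rw [map_add] at hh
  rw [nabla_apply, lie_of_eq_zero hS.1 (N.isSmooth_h hX.J)
    (fun p hp => N.hor_of_vertical hp (p := A.JSec X p) rfl) hw,
    lie_congr_right hS.1 hX.J hJ hw, map_zero, zero_add, h_apply]
  have h2 := N.hor_add_ver (A.lie S (A.JSec X) w)
  rw [eq_neg_of_add_eq_zero_left hh] at h2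
  conv_rhs => rw [← h2]
  abel

/-- `∇J = L_S J + 𝒩` for every nonlinear connection `𝒩`. -/
lemma nabla_J_sub_J_nabla (hS : A.IsSemispray S) (hX : A.IsSmooth X) (hw : w ∈ slit m E) :
    N.nabla S (A.JSec X) w - A.JSec (N.nabla S X) w = N.lieJAdd S X w := by
  change N.nabla S (A.JSec X) w - A.J (N.nabla S X w) = _
  rw [N.nabla_J hS hX hw, N.J_nabla hS hX hw, lieJAdd_apply, ← N.hor_sub_ver, h_apply, v_apply]
  abel

lemma nablaJZero_iff (hS : A.IsSemispray S) : N.NablaJZero S ↔ N.LieJAddZero S :=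
  forall₂_congr fun _ hX => forall₂_congr fun _ hw => by
    rw [N.nabla_J_sub_J_nabla hS hX hw, lieJAdd]

/-! ### The Leibniz rule on Newtonoid sections -/

lemma star_eq (hS : A.IsSmooth S) {f : TotalSpace (Fib m) E → ℝ}
    (hf : ContMDiffOn (totModel n m) 𝓘(ℝ, ℝ) ∞ f (slit m E)) (hX : X ∈ A.newtonoid S)
    (hw : w ∈ slit m E) :
    A.star S f X w = f w • X w + A.along S f w • A.JSec X w := by
  rw [star, lie_smul_right hS hX.1 hf hw, J_add, J_smul, J_smul, hX.2 w hw, smul_zero, add_zero]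
  rfl

/-- The defect of the Leibniz rule is `S(f) (L_S J + 𝒩)(X)`. -/
lemma leibniz_defect (hS : A.IsSemispray S) {f : TotalSpace (Fib m) E → ℝ}
    (hf : ContMDiffOn (totModel n m) 𝓘(ℝ, ℝ) ∞ f (slit m E)) (hX : X ∈ A.newtonoid S)
    (hN : N.nabla S X ∈ A.newtonoid S) (hw : w ∈ slit m E) :
    N.nabla S (A.star S f X) w
      = A.star S (A.along S f) X w + A.star S f (N.nabla S X) w
        + A.along S f w • N.lieJAdd S X w := by
  have hSf := hS.1.contMDiffOn_along isOpen_slit subset_rfl hf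
  rw [N.nabla_congr hS.1 ((hX.1.smul hf).add (hX.1.J.smul hSf))
      (fun p hp => star_eq hS.1 hf hX hp) hw,
    N.nabla_add hS.1 (hX.1.smul hf) (hX.1.J.smul hSf) hw, N.nabla_smul hS.1 hX.1 hf hw,
    N.nabla_smul hS.1 hX.1.J hSf hw, star_eq hS.1 hSf hX hw, star_eq hS.1 hf hN hw,
    ← N.nabla_J_sub_J_nabla hS hX.1 hw]
  module

/-- Put P = [S, hX] and Q = [S, vX], so that ∇X = hP + vQ. As J[S, X] = 0, one has JP = vX and h[S,
X] = 0. Applying L_S J + 𝒩 = 0 to hP gives J[S, hP] = Q + hP, while J[S, vQ] = -vQ. The sum is hQ +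
hP = h[S, X] = 0. -/
lemma nabla_mem_newtonoid (hS : A.IsSemispray S) (h : N.LieJAddZero S)
    (hX : X ∈ A.newtonoid S) : N.nabla S X ∈ A.newtonoid S := by
  refine ⟨N.isSmooth_nabla hS.1 hX.1, fun w hw => ?_⟩
  have hh := N.isSmooth_h hX.1
  have hv := N.isSmooth_v hX.1
  have hA := hS.1.lie hh
  have hB := hS.1.lie hv
  have e1 : A.J (A.lie S (N.h (A.lie S (N.h X))) w)
      = A.lie S (N.v X) w + N.hor w (A.lie S (N.h X) w) := by
    have h1 := h _ (N.isSmooth_h hA) w hw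
    rw [lie_congr_right hS.1 hv (fun p hp => ?_) hw, h_apply, N.toFun_hor hw] at h1
    · rw [← sub_eq_zero, ← neg_eq_zero, ← h1]
      change _ = _ - A.J _ + _
      abel
    · change A.J (N.hor p (A.lie S (N.h X) p)) = _
      rw [N.J_hor hp, N.J_lie_h hS hX.1 hp, hX.2 p hp, zero_add]
  have e2 : A.J (A.lie S (N.v (A.lie S (N.v X))) w) = -N.ver w (A.lie S (N.v X) w) :=
    hS.J_lie_vertical (N.isSmooth_v hB) (fun p hp => N.ver_fst hp _) hw
  have e3 : N.hor w (A.lie S (N.h X) w) + N.hor w (A.lie S (N.v X) w) = 0 := by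
    rw [← map_add, ← lie_add_right hS.1 hh hv hw,
      lie_congr_right (Z := fun p => N.h X p + N.v X p) hS.1 hX.1 (fun p _ => N.hor_add_ver (X p)) hw]
    exact N.hor_of_vertical hw (J_eq_zero_iff.1 (hX.2 w hw))
  have e4 := lie_add_right hS.1 (N.isSmooth_h hA) (N.isSmooth_v hB) hw
  refine (congrArg A.J e4).trans ?_
  rw [J_add, e1, e2, ← e3]
  calc A.lie S (N.v X) w + N.hor w (A.lie S (N.h X) w) + -N.ver w (A.lie S (N.v X) w)
      = N.hor w (A.lie S (N.v X) w) + N.ver w (A.lie S (N.v X) w)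
        + N.hor w (A.lie S (N.h X) w) + -N.ver w (A.lie S (N.v X) w) := by
          rw [N.hor_add_ver]
    _ = _ := by abel

lemma restrictsWithLeibniz (hS : A.IsSemispray S) (h : N.LieJAddZero S) :
    N.RestrictsWithLeibniz S := by
  refine ⟨fun X hX => N.nabla_mem_newtonoid hS h hX, fun f hf X hX w hw => ?_⟩
  have h1 : N.lieJAdd S X w = 0 := h X hX.1 w hw
  rw [N.leibniz_defect hS hf hX (N.nabla_mem_newtonoid hS h hX) hw, h1, smul_zero, add_zero]

/-! ### Local coordinates of `L_S J + 𝒩` -/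

lemma mdifferentiableAt_yCoord {s : Fin m → ∀ x : M, E x} {U : Set M} (hU : IsOpen U)
    (hs : IsLocalFrameOn (𝓡 n) (Fib m) ∞ s U) (β : Fin m) (hw : w.proj ∈ U) :
    MDifferentiableAt (totModel n m) 𝓘(ℝ, ℝ) (yCoord hs β) w :=
  ((contMDiffOn_yCoord hU hs β).contMDiffAt
    ((isOpen_proj_preimage hU).mem_nhds hw)).mdifferentiableAt (by simp)


/-- `xLift` is tangent to the local section `constSec`, along which every fibre coordinate is
constant. -/
lemma mvfderiv_yCoord_xLift {s : Fin m → ∀ x : M, E x} {U : Set M} (hU : IsOpen U)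
    (hs : IsLocalFrameOn (𝓡 n) (Fib m) ∞ s U) (α β : Fin m) (hw : w.proj ∈ U) :
    mvfderiv (totModel n m) (yCoord hs β) w (A.xLift hs α w) = 0 := by
  have hsm : ContMDiffAt (𝓡 n) (totModel n m) ∞ (constSec hs w) w.proj :=
    ContMDiffAt.sum_section (V := E) (F := Fib m) (t := fun γ x => yCoord hs γ w • s γ x)
      fun γ _ => (hs.contMDiffAt hU hw γ).const_smul_section
  have hw' : constSec hs w w.proj = w := congrArg (TotalSpace.mk w.proj) (sum_coeff_smul hs hw w.2)
  have h := mvfderiv_comp_apply_of_eq w.proj (mdifferentiableAt_yCoord hU hs β hw)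
    (hsm.mdifferentiableAt (by simp)) hw' (A.anchor w.proj (s α w.proj))
  refine h.symm.trans ?_
  refine (mvfderiv_congr (g := fun _ => yCoord hs β w) ?_ _).trans ?_
  · filter_upwards [hU.mem_nhds hw] with x hx
    exact coeff_sum_smul hs hx _ β
  · rw [mvfderiv_const]; rfl

/-- With q = p^α 𝒳_α, the difference p - q is vertical, so 𝒩 changes its sign, while 𝒳_α(y^β) = 0
and the derivative of y^β along 𝒩(𝒳_α) is -2𝒩_α^β. -/
lemma along_toFun_yCoord {s : Fin m → ∀ x : M, E x} {U : Set M} (hU : IsOpen U)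
    (hs : IsLocalFrameOn (𝓡 n) (Fib m) ∞ s U) (β : Fin m) (hw : w ∈ slit m E) (hwU : w.proj ∈ U)
    (p : A.Prol w) :
    mvfderiv (totModel n m) (yCoord hs β) w (N.toFun w p).1.2
      = -(∑ α, hs.coeff α w.proj p.1.1 * (2 * N.coeff hU hs α β w hwU))
        - mvfderiv (totModel n m) (yCoord hs β) w p.1.2 := by
  set q : A.Prol w := ∑ α, hs.coeff α w.proj p.1.1 • A.basisX hU hs α w hwU with hq
  have hqf : q.1.1 = p.1.1 := by
    refine Eq.trans ?_ (sum_coeff_smul hs hwU p.1.1)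
    have := map_sum (LinearMap.fst ℝ (E w.proj) (TangentSpace (totModel n m) w) ∘ₗ
      (A.Prol w).subtype) (fun α => hs.coeff α w.proj p.1.1 • A.basisX hU hs α w hwU) Finset.univ
    exact this
  set D : A.Prol w →ₗ[ℝ] ℝ := (mvfderiv (totModel n m) (yCoord hs β) w).toLinearMap ∘ₗ
    LinearMap.snd ℝ (E w.proj) (TangentSpace (totModel n m) w) ∘ₗ (A.Prol w).subtype with hD
  have hv : N.toFun w (p - q) = -(p - q) :=
    N.toFun_of_vertical hw (show p.1.1 - q.1.1 = 0 by rw [hqf, sub_self])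
  have hNp : N.toFun w p = N.toFun w q - (p - q) := by
    rw [map_sub] at hv
    rw [sub_eq_iff_eq_add'.1 hv]
    abel
  have hDq : D q = 0 := by
    rw [hq, map_sum]
    refine Finset.sum_eq_zero fun α _ => ?_
    rw [map_smul]
    have : D (A.basisX hU hs α w hwU) = 0 := mvfderiv_yCoord_xLift hU hs α β hwU
    rw [this, smul_zero]
  have hDN : D (N.toFun w q) = -(∑ α, hs.coeff α w.proj p.1.1 * (2 * N.coeff hU hs α β w hwU)) := by
    rw [hq, map_sum, map_sum, ← Finset.sum_neg_distrib]
    refine Finset.sum_congr rfl fun α _ => ?_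
    rw [map_smul, map_smul, smul_eq_mul, ← mul_neg]
    congr 1
    have : N.coeff hU hs α β w hwU = -(1 / 2) * D (N.toFun w (A.basisX hU hs α w hwU)) := rfl
    rw [this]
    ring
  change D (N.toFun w p) = _ - D p
  rw [hNp, map_sub, map_sub, hDq, hDN, sub_zero]

/-- The fibre coordinates of the vertical element `(L_S J + 𝒩)(X)`. -/
lemma along_lieJAdd_yCoord (hS : A.IsSemispray S) (hX : A.IsSmooth X)
    {s : Fin m → ∀ x : M, E x} {U : Set M} (hU : IsOpen U)
    (hs : IsLocalFrameOn (𝓡 n) (Fib m) ∞ s U) (β : Fin m) (hw : w ∈ slit m E) (hwU : w.proj ∈ U) :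
    A.along (N.lieJAdd S X) (yCoord hs β) w
      = ∑ α, hs.coeff α w.proj (X w).1.1 * (-partialY s α (A.semisprayCoeff S hs β) w
          + ∑ ε, yCoord hs ε w * A.structFun hs α ε β w.proj - 2 * N.coeff hU hs α β w hwU) := by
  have hO := isOpen_slit_inter (m := m) (E := E) hU
  have hyO : ContMDiffOn (totModel n m) 𝓘(ℝ, ℝ) ∞ (yCoord hs β)
      (slit m E ∩ TotalSpace.proj ⁻¹' U) := (contMDiffOn_yCoord hU hs β).mono inter_subset_right
  set D : A.Prol w →ₗ[ℝ] ℝ := (mvfderiv (totModel n m) (yCoord hs β) w).toLinearMap ∘ₗ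
    LinearMap.snd ℝ (E w.proj) (TangentSpace (totModel n m) w) ∘ₗ (A.Prol w).subtype with hD
  have hSC : MDifferentiableAt (totModel n m) 𝓘(ℝ, ℝ) (A.semisprayCoeff S hs β) w :=
    ((hS.1.contMDiffOn_along hO inter_subset_left hyO).contMDiffAt
      (hO.mem_nhds ⟨hw, hwU⟩)).mdifferentiableAt (by simp)
  -- Commutator formula: [S, JX](y^β) = S(JX(y^β)) - JX(S(y^β)), with JX(y^β) = X^β and S(y^β) =
  -- S^β.
  have h1 : D (A.lie S (A.JSec X) w) = A.along S (fun p => hs.coeff β p.proj (X p).1.1) w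
      - ∑ α, hs.coeff α w.proj (X w).1.1 * partialY s α (A.semisprayCoeff S hs β) w := by
    change mvfderiv (totModel n m) (yCoord hs β) w (A.lie S (A.JSec X) w).1.2 = _
    rw [lie_snd hS.1 hX.J hw]
    refine (mvfderiv_mlieBracket hO ⟨hw, hwU⟩ hyO (A.isSmooth_iff.1 hS.1 w hw).2
      (A.isSmooth_iff.1 hX.J w hw).2).trans ?_
    refine congrArg₂ (· - ·) ?_ ?_
    · refine mvfderiv_congr ?_ _
      filter_upwards [hO.mem_nhds ⟨hw, hwU⟩] with p hp
      exact mvfderiv_yCoord_vlift hU hs β hp.2 (X p).1.1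
    · change mvfderiv (totModel n m) (A.semisprayCoeff S hs β) w (vlift w (X w).1.1) = _
      have hlin : vlift (n := n) w (X w).1.1
          = ∑ α, hs.coeff α w.proj (X w).1.1 • vlift (n := n) w (s α w.proj) := by
        set L : E w.proj →ₗ[ℝ] TangentSpace (totModel n m) w :=
          { toFun := vlift w, map_add' := vlift_add w, map_smul' := vlift_smul w }
        change L (X w).1.1 = ∑ α, hs.coeff α w.proj (X w).1.1 • L (s α w.proj)
        conv_lhs => rw [← sum_coeff_smul hs hwU (X w).1.1, map_sum]
        exact Finset.sum_congr rfl fun α _ => map_smul _ _ _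
      rw [hlin, map_sum]
      refine Finset.sum_congr rfl fun α _ => ?_
      rw [map_smul, mvfderiv_vlift (s α w.proj) hSC]
      rfl
  -- Along a vertical lift, y^β returns the β-th coefficient, so this is the coefficient of the
  -- E-part of [S, X]. The coefficients of S are the y^α, which gives the term X(y^β); skew-symmetry
  -- of L exchanges its lower indices.
  have h2 : D (A.J (A.lie S X w)) = A.along S (fun p => hs.coeff β p.proj (X p).1.1) w
      - D (X w) - ∑ α, hs.coeff α w.proj (X w).1.1 *
        ∑ ε, yCoord hs ε w * A.structFun hs α ε β w.proj := by
    have e1 : D (A.J (A.lie S X w)) = hs.coeff β w.proj (A.lie S X w).1.1 :=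
      mvfderiv_yCoord_vlift hU hs β hwU _
    have e2 : A.along X (fun p => hs.coeff β p.proj (S p).1.1) w = D (X w) := by
      refine mvfderiv_congr ?_ _
      filter_upwards [slit_mem_nhds hw] with p hp
      rw [hS.fst hp]
      rfl
    have e3 : ∀ a b, A.structFun hs a b β w.proj = -A.structFun hs b a β w.proj := fun a b => by
      rw [structFun, structFun,
        A.localBracket_skew hU hwU (hs.contMDiffOn a) (hs.contMDiffOn b), map_neg]
    rw [e1, coeff_lie hS.1 hX hw hU hs hwU, e2, hS.fst hw, sub_eq_add_neg (_ - _) (∑ _, _)]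
    congr 1
    rw [Finset.sum_comm, ← Finset.sum_neg_distrib]
    refine Finset.sum_congr rfl fun a _ => ?_
    rw [Finset.mul_sum, ← Finset.sum_neg_distrib]
    refine Finset.sum_congr rfl fun b _ => ?_
    rw [e3 b a, yCoord]
    ring
  have h3 : D (N.toFun w (X w))
      = -(∑ α, hs.coeff α w.proj (X w).1.1 * (2 * N.coeff hU hs α β w hwU)) - D (X w) :=
    N.along_toFun_yCoord hU hs β hw hwU (X w)
  change D (A.lie S (A.JSec X) w - A.J (A.lie S X w) + N.toFun w (X w)) = _
  -- S(X^β) cancels between `h1` and `h2`, and X(y^β) between `h2` and `h3`; what remains is linear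
  -- in the coefficients of X at w.
  rw [map_add, map_sub, h1, h2, h3]
  simp only [mul_sub, mul_add, Finset.sum_add_distrib, Finset.sum_sub_distrib, mul_neg,
    Finset.sum_neg_distrib]
  ring

lemma lieJAdd_eq_zero (hS : A.IsSemispray S) (hX : A.IsSmooth X) (hw : w ∈ slit m E)
    (h : ∀ i, A.along (N.lieJAdd S X)
      (yCoord (isLocalFrameOn_frameAt (n := n) (m := m) (E := E) w.proj) i) w = 0) :
    N.lieJAdd S X w = 0 := by
  have hwe : w.proj ∈ (trivializationAt (Fib m) E w.proj).baseSet :=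
    FiberBundle.mem_baseSet_trivializationAt' w.proj
  have h0 := N.lieJAdd_fst hS hX hw
  refine Subtype.ext (Prod.ext h0 (ext_tangent ?_ fun i => ?_))
  · rw [A.mfderiv_proj_snd, h0, map_zero]
    exact (map_zero _).symm
  · rw [mvfderiv_congr (frameCoeff_eventuallyEq (n := n) hwe i)]
    exact (h i).trans (map_zero _).symm

lemma lieJAddZero_iff (hS : A.IsSemispray S) : N.LieJAddZero S ↔ N.LocalFormula S := by
  constructor
  · intro h U hU s hs α β w hw hwU
    -- The coordinate expression depends only on the E-part of X at w; choosing it to be s_α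
    -- isolates the index α.
    obtain ⟨X, hX, hXw⟩ := hS.exists_isSmooth_fst hw (s α w.proj)
    have h1 := N.along_lieJAdd_yCoord hS hX hU hs β hw hwU
    have h2 : N.lieJAdd S X w = 0 := h X hX w hw
    rw [along, h2, hXw] at h1
    have h3 : mvfderiv (totModel n m) (yCoord hs β) w (0 : A.Prol w).1.2 = 0 := map_zero _
    rw [h3] at h1
    simp only [coeff_self hs hwU, ite_mul, one_mul, zero_mul, Finset.sum_ite_eq',
      Finset.mem_univ, if_true] at h1
    linarith
  · intro h X hX w hw
    refine N.lieJAdd_eq_zero hS hX hw fun i => ?_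
    have hwe : w.proj ∈ (trivializationAt (Fib m) E w.proj).baseSet :=
      FiberBundle.mem_baseSet_trivializationAt' w.proj
    have hU := (trivializationAt (Fib m) E w.proj).open_baseSet
    rw [N.along_lieJAdd_yCoord hS hX hU _ i hw hwe]
    refine Finset.sum_eq_zero fun α _ => ?_
    rw [h _ hU _ (isLocalFrameOn_frameAt w.proj) α i w hw hwe]
    ring

/-! ### The Leibniz rule implies `L_S J + 𝒩 = 0` -/

/-- Base and fibre coordinates detect a nonzero tangent vector. Both become global smooth functions
after multiplication by a bump function pulled back from M, so no cut-off in the fibre direction is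
needed. -/
lemma exists_along_ne_zero (hw : (S w).1.2 ≠ 0) :
    ∃ f : TotalSpace (Fib m) E → ℝ, ContMDiff (totModel n m) 𝓘(ℝ, ℝ) ∞ f ∧ A.along S f w ≠ 0 := by
  have hwe : w.proj ∈ (trivializationAt (Fib m) E w.proj).baseSet :=
    FiberBundle.mem_baseSet_trivializationAt' w.proj
  have hU := (trivializationAt (Fib m) E w.proj).open_baseSet
  by_contra! hf
  refine hw (ext_tangent ?_ fun i => ?_)
  · rw [map_zero]
    apply eq_of_coord_eq
    intro k
    obtain ⟨F, hF, hFe⟩ := exists_global_function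
      (chartAt (EuclideanSpace ℝ (Fin n)) w.proj).open_source
      (mem_chart_source (EuclideanSpace ℝ (Fin n)) w.proj)
      (((EuclideanSpace.proj k : EuclideanSpace ℝ (Fin n) →L[ℝ] ℝ).contDiff.contMDiff
        (n := ∞)).comp_contMDiffOn (contMDiffOn_extChartAt (I := 𝓡 n) (x := w.proj)))
    have h1 := hf (fun p => F p.proj) (hF.comp (contMDiff_proj E))
    have h2 := mvfderiv_comp_apply w ((hF w.proj).mdifferentiableAt (by simp))
      (mdifferentiableAt_proj w) (S w).1.2
    refine Eq.trans ?_ (map_zero _).symm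
    refine Eq.trans ?_ (h2.symm.trans h1)
    exact (mvfderiv_congr hFe _).symm
  · rw [map_zero]
    obtain ⟨b, -, hb⟩ := (SmoothBumpFunction.nhds_basis_tsupport (I := 𝓡 n) w.proj).mem_iff.1
      (hU.mem_nhds hwe)
    have hsm : ContMDiff (totModel n m) 𝓘(ℝ, ℝ) ∞
        (fun p : TotalSpace (Fib m) E => b p.proj * frameCoeff m E w.proj i p) := by
      intro p
      by_cases hp : p.proj ∈ (trivializationAt (Fib m) E w.proj).baseSet
      · exact ((b.contMDiff p.proj).comp p (contMDiff_proj E p)).mul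
          ((contMDiffOn_frameCoeff w.proj i).contMDiffAt ((isOpen_proj_preimage hU).mem_nhds hp))
      · have hp' : p.proj ∈ (tsupport b)ᶜ := fun h => hp (hb h)
        refine (contMDiffAt_const (c := (0 : ℝ))).congr_of_eventuallyEq ?_
        filter_upwards [(isOpen_proj_preimage (isClosed_tsupport b).isOpen_compl).mem_nhds hp']
          with q hq
        rw [image_eq_zero_of_notMem_tsupport hq, zero_mul]
    refine Eq.trans (mvfderiv_congr ?_ _) (hf _ hsm)
    filter_upwards [(FiberBundle.continuous_proj (Fib m) E).continuousAt.eventually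
      b.eventuallyEq_one] with p hp
    rw [hp, Pi.one_apply, one_mul]

lemma lieJAddZero_of_restrictsWithLeibniz (hS : A.IsSemispray S)
    (hne : ∀ O : Set (TotalSpace (Fib m) E), IsOpen O → O.Nonempty → O ⊆ slit m E →
      ∃ w ∈ O, (S w).1.2 ≠ 0) (h : N.RestrictsWithLeibniz S) : N.LieJAddZero S := by
  have key : ∀ X ∈ A.newtonoid S, ∀ w ∈ slit m E, N.lieJAdd S X w = 0 := by
    intro X hX w hw
    refine N.lieJAdd_eq_zero hS hX.1 hw fun i => ?_
    by_contra hi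
    have hwe : w.proj ∈ (trivializationAt (Fib m) E w.proj).baseSet :=
      FiberBundle.mem_baseSet_trivializationAt' w.proj
    have hU := (trivializationAt (Fib m) E w.proj).open_baseSet
    set fr := isLocalFrameOn_frameAt (n := n) (m := m) (E := E) w.proj
    have hO := isOpen_slit_inter (m := m) (E := E) hU
    -- By continuity, a fibre coordinate of (L_S J + 𝒩)X that is nonzero at w is nonzero on an open
    -- set, where the hypothesis provides a point with σ¹(S) ≠ 0.
    have hc := ((N.isSmooth_lieJAdd hS.1 hX.1).contMDiffOn_along hO inter_subset_left
      ((contMDiffOn_yCoord hU fr i).mono inter_subset_right)).continuousOn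
    obtain ⟨w', hw', hSw'⟩ := hne _ (hc.isOpen_inter_preimage hO isOpen_ne) ⟨w, ⟨hw, hwe⟩, hi⟩
      (inter_subset_left.trans inter_subset_left)
    obtain ⟨f, hf, hfne⟩ := exists_along_ne_zero hSw'
    have h1 := N.leibniz_defect hS hf.contMDiffOn hX (h.1 X hX) hw'.1.1
    rw [h.2 f hf.contMDiffOn X hX w' hw'.1.1] at h1
    have h2 := (smul_eq_zero.1 (left_eq_add.1 h1)).resolve_left hfne
    refine hw'.2 ?_
    change mvfderiv (totModel n m) (yCoord fr i) w' (N.lieJAdd S X w').1.2 = 0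
    rw [h2]
    exact map_zero _
  intro X hX w hw
  have hJL := (hS.1.lie hX).J
  -- Since J[S, J[S, X]] = -J[S, X], adding J[S, X] makes any section Newtonoid. The correction is
  -- vertical and invisible to L_S J + 𝒩: on Y' = JY this gives 0 - J[S, Y'] + 𝒩Y' = Y' - Y' = 0.
  have hnew : (fun p => X p + A.JSec (A.lie S X) p) ∈ A.newtonoid S := by
    refine ⟨hX.add hJL, fun p hp => ?_⟩
    rw [lie_add_right hS.1 hX hJL hp, J_add, hS.J_lie_vertical hJL (fun _ _ => rfl) hp]
    exact add_neg_cancel _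
  have h1 := key _ hnew w hw
  rw [lieJAdd_apply, lie_add_right hS.1 hX hJL hw, J_add,
    hS.J_lie_vertical hJL (fun _ _ => rfl) hw, map_add,
    N.toFun_of_vertical hw (p := A.JSec (A.lie S X) w) rfl,
    lie_congr_right (Z := A.JSec fun p => X p + A.JSec (A.lie S X) p) hS.1 hX.J
      (fun p _ => (J_add _ _).trans ((congrArg _ (J_J _)).trans (add_zero _))) hw] at h1
  have e : A.JSec (A.lie S X) w = A.J (A.lie S X w) := rfl
  rw [← h1, e]
  abel

end NonlinearConnection

end LieAlgebroid

end

/-! ### The equivalence of the four conditions -/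

theorem proposition13 {n m : ℕ} {M : Type*} [TopologicalSpace M] [T2Space M]
    [ChartedSpace (EuclideanSpace ℝ (Fin n)) M] [IsManifold (𝓡 n) ∞ M]
    {E : M → Type*} [TopologicalSpace (TotalSpace (Fib m) E)]
    [∀ x, AddCommGroup (E x)] [∀ x, Module ℝ (E x)] [∀ x, TopologicalSpace (E x)]
    [FiberBundle (Fib m) E] [VectorBundle ℝ (Fib m) E]
    [ContMDiffVectorBundle ∞ (Fib m) E (𝓡 n)]
    (A : LieAlgebroid n m E) (S : A.Sec) (hS : A.IsSemispray S) (N : A.NonlinearConnection) :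
    -- if `σ¹(S)` does not vanish identically on any nonempty open subset of `E∖{0}`,
    -- all four conditions are equivalent
    ((∀ O : Set (TotalSpace (Fib m) E), IsOpen O → O.Nonempty → O ⊆ LieAlgebroid.slit m E →
        ∃ w ∈ O, (S w).1.2 ≠ 0) →
      List.TFAE [N.RestrictsWithLeibniz S, N.NablaJZero S, N.LieJAddZero S, N.LocalFormula S])
    -- without that assumption, the last three are equivalent and imply the first
    ∧ List.TFAE [N.NablaJZero S, N.LieJAddZero S, N.LocalFormula S]
    ∧ (N.NablaJZero S → N.RestrictsWithLeibniz S) := by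
  have h23 := N.nablaJZero_iff hS
  have h34 := N.lieJAddZero_iff hS
  refine ⟨fun hne => ?_, ?_, fun h => N.restrictsWithLeibniz hS (h23.1 h)⟩
  · tfae_have 1 → 3 := N.lieJAddZero_of_restrictsWithLeibniz hS hne
    tfae_have 3 → 1 := N.restrictsWithLeibniz hS
    tfae_have 2 ↔ 3 := h23
    tfae_have 3 ↔ 4 := h34
    tfae_finish
  · tfae_have 1 ↔ 2 := h23
    tfae_have 2 ↔ 3 := h34
    tfae_finish
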